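/- Let $(X_t)_{t\in\mathbb Z}$ be a strictly stationary sequence of real-valued random variables with generic element $X$, and put $S_0=0$, $S_n=X_1+\cdots+X_n$ for $n\ge 1$. Assume: (i) for some integer $m_0\ge 1$ the sequence is $m_0$-dependent, i.e. for every $t\in\mathbb Z$ the families $(X_s)_{s\le t}$ and $(X_s)_{s>t+m_0}$ are independent; (ii) $(X_t)$ is regularly varying with index $\alpha>0$, i.e. there are $a_n>0$ with $n\,\mathbb P(|X|>a_n)\to 1$ such that for every $d\ge 1$ there is a non-null Radon measure $\mu_d$ on $[-\infty,\infty]^d\setminus\{0\}$ (finite on sets bounded away from $0$), with $\mu_d(tA)=t^{-\alpha}\mu_d(A)$ for all $t>0$ and all Borel sets $A$, to which the measures $n\,\mathbb P(a_n^{-1}(X_1,\ldots,X_d)\in\cdot)$ converge vaguely as $n\to\infty$; (iii) $\mathbb E X=0$ if $\mathbb E|X|<\infty$. Then for every $k\ge 1$ the limit $$b_+(k)=\lim_{x\to\infty}\frac{\mathbb P(S_k>x)}{\mathbb P(|X|>x)}$$ exists and is finite, the limit $b_+=\lim_{k\to\infty}\big(b_+(k+1)-b_+(k)\big)$ exists and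 equals $b_+(m_0+1)-b_+(m_0)$, and for every $\delta>0$, with $b_n=n^{\max(1/\alpha,\,1/2)+\delta}$ and $\Lambda_n=(b_n,\infty)$, $$\lim_{n\to\infty}\ \sup_{x\in\Lambda_n}\left|\frac{\mathbb P(S_n>x)}{n\,\mathbb P(|X|>x)}-b_+\right|=0 .$$ -/

import Mathlib

open MeasureTheory ProbabilityTheory Filter Topology

/-- The sequence `(X_t)`, `t ∈ ℤ`, is (strictly) stationary: every shifted sequence has the
same law on `ℝ^ℤ` as the original one. -/
def IsStrictlyStationary {Ω : Type*} [MeasurableSpace Ω] (P : Measure Ω) (X : ℤ → Ω → ℝ) : Prop :=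
  ∀ h : ℤ, P.map (fun ω (t : ℤ) => X (t + h) ω) = P.map (fun ω (t : ℤ) => X t ω)

/-- The sequence `(X_t)` is `m`-dependent: for every time `t`, the past `(X_s)_{s ≤ t}` and the
future `(X_s)_{s > t + m}` are independent. -/
def IsMDependent {Ω : Type*} [MeasurableSpace Ω] (P : Measure Ω) (X : ℤ → Ω → ℝ) (m : ℕ) :
    Prop :=
  ∀ t : ℤ, IndepFun (fun ω (s : Set.Iic t) => X s ω)
    (fun ω (s : Set.Ioi (t + (m : ℤ))) => X s ω) P

/-- `μ` is a non-null Radon measure on the punctured compactified space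
`[-∞, ∞]^d \ {0}` (seen as a measure on `[-∞, ∞]^d` that does not charge the origin):
it is finite on all sets bounded away from the origin. -/
structure IsNonnullRadonPunctured {d : ℕ} (μ : Measure (Fin d → EReal)) : Prop where
  ne_zero : μ ≠ 0
  origin : μ {0} = 0
  finite_away : ∀ U ∈ 𝓝 (0 : Fin d → EReal), μ Uᶜ < ⊤

/-- The measure `μ` is homogeneous of order `-α`: `μ (t A) = t ^ (-α) μ A` for all `t > 0` and
all Borel sets `A`. -/
def IsHomogeneousMeasure {d : ℕ} (μ : Measure (Fin d → EReal)) (α : ℝ) : Prop :=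
  ∀ t : ℝ, 0 < t → ∀ A : Set (Fin d → EReal), MeasurableSet A →
    μ ((fun y i => (t : EReal) * y i) '' A) = ENNReal.ofReal (t ^ (-α)) * μ A

/-- Vague convergence on `[-∞, ∞]^d \ {0}` of the measures
`n P (a_n⁻¹ (X_1, …, X_d) ∈ ·)` to `μ`. As `[-∞, ∞]^d` is compact, a continuous
function on the punctured space has compact support exactly when (extended by `0`) it is a
continuous function on `[-∞, ∞]^d` whose closed support does not contain the origin. -/
def VagueLimit {Ω : Type*} [MeasurableSpace Ω] (P : Measure Ω) (X : ℤ → Ω → ℝ) (a : ℕ → ℝ)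
    (d : ℕ) (μ : Measure (Fin d → EReal)) : Prop :=
  ∀ f : (Fin d → EReal) → ℝ, Continuous f → (0 : Fin d → EReal) ∉ tsupport f →
    Tendsto
      (fun n : ℕ => (n : ℝ) *
        ∫ ω, f (fun i : Fin d => (((a n)⁻¹ * X ((i : ℤ) + 1) ω : ℝ) : EReal)) ∂P)
      atTop (𝓝 (∫ y, f y ∂μ))

/-- The (stationary) sequence `(X_t)` is regularly varying with index `α`: with a
normalizing sequence `(a_n)` such that `n P (|X| > a_n) → 1`, for every `d ≥ 1` the measures
`n P (a_n⁻¹ (X_1, …, X_d) ∈ ·)` converge vaguely on `[-∞, ∞]^d \ {0}` to a non-null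
Radon measure which is homogeneous of order `-α`. -/
def IsRegularlyVarying {Ω : Type*} [MeasurableSpace Ω] (P : Measure Ω) (X : ℤ → Ω → ℝ)
    (α : ℝ) : Prop :=
  ∃ a : ℕ → ℝ, (∀ n, 0 < a n) ∧
    Tendsto (fun n : ℕ => (n : ℝ) * P.real {ω | a n < |X 0 ω|}) atTop (𝓝 1) ∧
    ∀ d : ℕ, 1 ≤ d → ∃ μ : Measure (Fin d → EReal),
      IsNonnullRadonPunctured μ ∧ VagueLimit P X a d μ ∧ IsHomogeneousMeasure μ α

/-- The partial sum `S_n = X_1 + ⋯ + X_n`, with `S_0 = 0`. -/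
def partialSum {Ω : Type*} (X : ℤ → Ω → ℝ) (n : ℕ) (ω : Ω) : ℝ :=
  ∑ i ∈ Finset.Icc 1 n, X (i : ℤ) ω

/-- `c = b_+(k)`, i.e. `c = lim_{x → ∞} P (S_k > x) / P (|X| > x)`. -/
def IsTailConstant {Ω : Type*} [MeasurableSpace Ω] (P : Measure Ω) (X : ℤ → Ω → ℝ) (k : ℕ)
    (c : ℝ) : Prop :=
  Tendsto (fun x : ℝ => P.real {ω | x < partialSum X k ω} / P.real {ω | x < |X 0 ω|})
    atTop (𝓝 c)

/-- The precise large deviation principle in the regions `Λ_n` with limiting constant `b`: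
`lim_{n → ∞} sup_{x ∈ Λ_n} |P (S_n > x) / (n P (|X| > x)) - b| = 0`, the supremum being
taken in `[0, ∞]`. -/
def PreciseLargeDeviation {Ω : Type*} [MeasurableSpace Ω] (P : Measure Ω) (X : ℤ → Ω → ℝ)
    (Λ : ℕ → Set ℝ) (b : ℝ) : Prop :=
  Tendsto
    (fun n : ℕ => ⨆ x ∈ Λ n, ENNReal.ofReal
      |P.real {ω | x < partialSum X n ω} / ((n : ℝ) * P.real {ω | x < |X 0 ω|}) - b|)
    atTop (𝓝 0)

/-!
The proof rests on the principle of a single large cluster. Write `T x = P (|X| > x)` and split each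
variable at the level `ε x` into its truncation and its exceedance.

* The truncated variables contribute nothing (`exists_smallSum_tail`). Their sum splits into `m₀ + 1`
  sums of independent variables, one for each residue class modulo `m₀ + 1`. As `n < x ^ γ` for some
  `γ < min α 2`, and `X` has a moment of an order `β` between `γ` and `min α 2`, a Chernoff bound with
  parameter of order `log x / x` makes the probability that their sum exceeds `η x` smaller than any
  given power of `x`, whereas `T x` is at least a power of `x`. The mean condition enters only through
  the bound `abs_integral_trunc_le` on the truncated mean.
* For the sum of the exceedances, let `p k = P (∑_{i ≤ k} X_i 𝟙(|X_i| > ε x) > z)`. By stationarity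
  `p (k + 1) - p k` is the effect of adding one variable at the start; this effect is nonzero only if
  that variable is an exceedance, and then, up to an event of probability at most `k T(ε x) ^ 2`, there
  is no further exceedance after time `m₀ + 1`. Hence `p (k + 1) - p k` is close to
  `p (m₀ + 1) - p m₀` for `k ≥ m₀` (`abs_increment_bigSum_le`), and telescoping shows that `p n` is
  close to `p m₀ + (n - m₀) (p (m₀ + 1) - p m₀)` (`abs_bigSum_sub_le`).
* For a fixed number of summands and small `ε` the truncated part is bounded by `η x`, so `p m₀` and
  `p (m₀ + 1)` are sandwiched between tails of `S_{m₀}` and `S_{m₀ + 1}` at levels near `z`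
  (`measureReal_partialSum_bounds`).

Dividing by `n T x` and letting `η → 0` gives `tendsto_partialSum_div`. Its version for fixed `n`
yields `b n = b m₀ + (n - m₀) (b (m₀ + 1) - b m₀)` for `n ≥ m₀`, and its version along pairs `(n, x)`
with `x > n ^ q` yields the large deviation principle.

The tail constants themselves come from vague convergence (`VagueLimit.tendsto_homog`): homogeneity
forces the limit measure to charge neither infinite coordinates nor the level sets of a positively
homogeneous function, and a regular variation argument passes from the normalizing sequence to a
continuous level (`tendsto_div_of_tendsto_normalized`).
-/

/-! ### Vague convergence and null frontiers -/

/-- Portmanteau theorem for finite measures of varying mass. -/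
theorem tendsto_finiteMeasure_of_null_frontier {Y ι : Type*} {L : Filter ι}
    [MeasurableSpace Y] [TopologicalSpace Y] [OpensMeasurableSpace Y] [HasOuterApproxClosed Y]
    [Nonempty Y] {ν : FiniteMeasure Y} {νs : ι → FiniteMeasure Y}
    (h : Tendsto νs L (𝓝 ν)) {E : Set Y} (hE : ν (frontier E) = 0) :
    Tendsto (fun i => νs i E) L (𝓝 (ν E)) := by
  have hm := h.mass
  rcases eq_or_ne ν 0 with rfl | hν
  · refine tendsto_of_tendsto_of_tendsto_of_le_of_le tendsto_const_nhds hm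
      (fun _ => zero_le) (fun _ => ?_) |>.trans (by simp)
    exact FiniteMeasure.apply_le_mass _ _
  · have h1 := FiniteMeasure.tendsto_normalize_of_tendsto h hν
    have h2 : ν.normalize (frontier E) = 0 := by
      rw [FiniteMeasure.normalize_eq_of_nonzero _ hν, hE, mul_zero]
    have h3 := ProbabilityMeasure.tendsto_measure_of_null_frontier_of_tendsto h1 h2
    have h4 := hm.mul h3
    rw [← FiniteMeasure.self_eq_mass_mul_normalize] at h4
    refine h4.congr fun i => ?_
    rw [← FiniteMeasure.self_eq_mass_mul_normalize]

/-- A continuous weight with values in `[0, 1]` that vanishes near `y₀` and equals `1` off a given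
neighbourhood of `y₀`. It localizes vague convergence to weak convergence of finite measures. -/
theorem exists_continuous_weight {Y : Type*} [TopologicalSpace Y] [NormalSpace Y] [T1Space Y]
    (y₀ : Y) {W : Set Y} (hW : W ∈ 𝓝 y₀) :
    ∃ w : C(Y, ℝ), (∀ y, 0 ≤ w y) ∧ (∀ y, w y ≤ 1) ∧ (∀ y ∉ W, w y = 1) ∧
      ∃ s ∈ 𝓝 y₀, MeasurableSet[borel Y] s ∧ ∀ y ∈ s, w y = 0 := by
  obtain ⟨s, hs, hsc, hsW⟩ := exists_mem_nhds_isClosed_subset (interior_mem_nhds.2 hW)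
  obtain ⟨w, h0, h1, h2⟩ := exists_continuous_zero_one_of_isClosed hsc
    (isOpen_interior (s := W)).isClosed_compl (Set.disjoint_compl_right_iff_subset.2 hsW)
  refine ⟨w, fun y => (h2 y).1, fun y => (h2 y).2,
    fun y hy => h1 fun hy' => hy (interior_subset hy'), s, hs, ?_, fun y hy => h0 hy⟩
  borelize Y
  exact hsc.measurableSet

section
variable {Ω : Type*} [MeasurableSpace Ω] {P : Measure Ω} [IsProbabilityMeasure P] {X : ℤ → Ω → ℝ}
  {a : ℕ → ℝ} {d : ℕ} {μ : Measure (Fin d → EReal)}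

theorem measurable_scaledVector (hX : ∀ t, Measurable (X t)) (c : ℝ) :
    Measurable (fun ω => fun i : Fin d => ((c * X ((i : ℤ) + 1) ω : ℝ) : EReal)) :=
  measurable_pi_lambda _ fun _ => measurable_coe_real_ereal.comp ((hX _).const_mul c)

/-- Vague convergence on the punctured space gives convergence of the masses of the sets that are
bounded away from the origin and whose frontier is not charged by the limit. -/
theorem VagueLimit.tendsto_measureReal (hX : ∀ t, Measurable (X t))
    (hμ : IsNonnullRadonPunctured μ) (hv : VagueLimit P X a d μ)
    {E W : Set (Fin d → EReal)} (hE : MeasurableSet E) (hW : W ∈ 𝓝 0) (hEW : Disjoint E W)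
    (hfr : μ (frontier E) = 0) :
    Tendsto (fun n : ℕ => (n : ℝ) * P.real
      {ω | (fun i : Fin d => (((a n)⁻¹ * X ((i : ℤ) + 1) ω : ℝ) : EReal)) ∈ E}) atTop
      (𝓝 (μ.real E)) := by
  obtain ⟨w, hw0, hw1, hwW, s, hs, hsm, hws⟩ := exists_continuous_weight 0 hW
  have hsm : MeasurableSet s := by
    rwa [← BorelSpace.measurable_eq (α := Fin d → EReal)] at hsm
  set w' : (Fin d → EReal) → ENNReal := fun y => ENNReal.ofReal (w y) with hw'
  have hw'm : Measurable w' := (w.continuous.measurable).ennreal_ofReal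
  have hw'1 : ∀ y ∈ E, w' y = 1 := fun y hy => by
    simp [hw', hwW y (Set.disjoint_left.1 hEW hy)]
  have hw't : ∀ y, w' y < ⊤ := fun y => ENNReal.ofReal_lt_top
  have hfin : ∀ ρ : Measure (Fin d → EReal), ρ sᶜ < ⊤ → IsFiniteMeasure (ρ.withDensity w') := by
    intro ρ hρ
    refine ⟨?_⟩
    rw [withDensity_apply _ MeasurableSet.univ, Measure.restrict_univ]
    calc ∫⁻ y, w' y ∂ρ ≤ ∫⁻ y, sᶜ.indicator 1 y ∂ρ := by
          refine lintegral_mono fun y => ?_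
          by_cases hy : y ∈ s
          · simp [hw', hws y hy]
          · simp only [hw', Set.indicator, Set.mem_compl_iff, hy, not_false_eq_true, if_true]
            simpa using hw1 y
      _ = ρ sᶜ := lintegral_indicator_one hsm.compl
      _ < ⊤ := hρ
  let Z : ℕ → Ω → Fin d → EReal := fun n ω i => (((a n)⁻¹ * X ((i : ℤ) + 1) ω : ℝ) : EReal)
  have hZ : ∀ n, Measurable (Z n) := fun n => measurable_scaledVector hX _
  let ρ : ℕ → Measure (Fin d → EReal) := fun n => (n : ENNReal) • P.map (Z n)
  have hρ : ∀ n, IsFiniteMeasure (ρ n) := fun n => by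
    have : IsProbabilityMeasure (P.map (Z n)) := Measure.isProbabilityMeasure_map (hZ n).aemeasurable
    refine ⟨?_⟩
    simp [ρ]
  have hνfin := hfin μ (hμ.finite_away s hs)
  have hνsfin : ∀ n, IsFiniteMeasure ((ρ n).withDensity w') := fun n =>
    hfin _ (measure_lt_top _ _)
  let ν : FiniteMeasure (Fin d → EReal) := ⟨μ.withDensity w', hνfin⟩
  let νs : ℕ → FiniteMeasure (Fin d → EReal) := fun n => ⟨(ρ n).withDensity w', hνsfin n⟩
  have hconv : Tendsto νs atTop (𝓝 ν) := by
    rw [FiniteMeasure.tendsto_iff_forall_integral_tendsto]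
    intro f
    have hc : Continuous fun y => w y * f y := w.continuous.mul f.continuous
    have hns : (0 : Fin d → EReal) ∉ tsupport fun y => w y * f y := by
      rw [notMem_tsupport_iff_eventuallyEq]
      filter_upwards [hs] with y hy
      simp [hws y hy]
    have := hv _ hc hns
    have hI : ∀ κ : Measure (Fin d → EReal),
        ∫ y, f y ∂(κ.withDensity w') = ∫ y, w y * f y ∂κ := fun κ => by
      rw [integral_withDensity_eq_integral_toReal_smul hw'm (Eventually.of_forall hw't)]
      simp [hw', hw0]
    simp only [ν, νs, FiniteMeasure.toMeasure_mk, hI]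
    convert this using 2 with n
    simp only [ρ]
    rw [integral_smul_measure, integral_map (hZ n).aemeasurable hc.aestronglyMeasurable]
    simp [Z]
  have hEval : ∀ κ : Measure (Fin d → EReal), κ.withDensity w' E = κ E := fun κ => by
    rw [withDensity_apply _ hE, setLIntegral_congr_fun hE hw'1]
    simp
  have hνfr : ν (frontier E) = 0 := by
    have : μ.withDensity w' (frontier E) = 0 := withDensity_absolutelyContinuous _ _ hfr
    rw [← ENNReal.coe_eq_zero, FiniteMeasure.ennreal_coeFn_eq_coeFn_toMeasure]
    exact this
  have key := tendsto_finiteMeasure_of_null_frontier hconv hνfr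
  have key' := (NNReal.tendsto_coe.2 key)
  have e1 : ((ν E : NNReal) : ℝ) = μ.real E := by
    rw [measureReal_def, ← hEval μ]; rfl
  rw [e1] at key'
  refine key'.congr fun n => ?_
  have : ((νs n E : NNReal) : ℝ) = (ρ n).real E := by
    rw [measureReal_def, ← hEval (ρ n)]; rfl
  rw [this]
  simp only [ρ, measureReal_def, Measure.smul_apply, smul_eq_mul, ENNReal.toReal_mul,
    ENNReal.toReal_natCast]
  rw [Measure.map_apply (hZ n) hE]
  rfl

/-! ### Homogeneous limit measures -/

/-- The points of `[-∞, ∞]^d` with finite coordinates. -/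
def finitePart (d : ℕ) : Set (Fin d → EReal) := {y | ∀ i, y i ≠ ⊥ ∧ y i ≠ ⊤}

theorem isOpen_finitePart (d : ℕ) : IsOpen (finitePart d) := by
  have : finitePart d = ⋂ i, (fun y : Fin d → EReal => y i) ⁻¹' {⊥, ⊤}ᶜ := by
    ext y; simp [finitePart]
  rw [this]
  exact isOpen_iInter_of_finite fun i =>
    (Set.Finite.isClosed (by simp)).isOpen_compl.preimage (continuous_apply i)

theorem zero_mem_finitePart : (0 : Fin d → EReal) ∈ finitePart d := fun i => by simp

theorem continuousOn_toReal_finitePart :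
    ContinuousOn (fun (y : Fin d → EReal) i => (y i).toReal) (finitePart d) :=
  continuousOn_pi.2 fun i => EReal.continuousOn_toReal.comp (continuous_apply i).continuousOn
    fun y hy => by simpa using hy i

theorem toReal_coe_mul (t : ℝ) (y : EReal) : ((t : EReal) * y).toReal = t * y.toReal := by
  simp [EReal.toReal_mul]

theorem scale_mem_finitePart (t : ℝ) {y : Fin d → EReal} (hy : y ∈ finitePart d) :
    (fun i => (t : EReal) * y i) ∈ finitePart d := fun i => by
  obtain ⟨h1, h2⟩ := hy i
  lift y i to ℝ using ⟨h2, h1⟩ with z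
  rw [← EReal.coe_mul]
  exact ⟨EReal.coe_ne_bot _, EReal.coe_ne_top _⟩

/-- Scaling by `t > 0` maps a set defined by a positively homogeneous function of the finite
coordinates to another one. -/
theorem image_scale_eq {g : (Fin d → ℝ) → ℝ} (hg : ∀ t : ℝ, 0 < t → ∀ x, g (t • x) = t * g x)
    {t : ℝ} (ht : 0 < t) (A : Set ℝ) :
    (fun (y : Fin d → EReal) i => (t : EReal) * y i) ''
      {y | y ∈ finitePart d ∧ g (fun i => (y i).toReal) ∈ A} =
      {y | y ∈ finitePart d ∧ t⁻¹ * g (fun i => (y i).toReal) ∈ A} := by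
  have hgt : ∀ (s : ℝ), 0 < s → ∀ y : Fin d → EReal,
      g (fun i => ((s : EReal) * y i).toReal) = s * g (fun i => (y i).toReal) := fun s hs y => by
    rw [← hg s hs]; congr 1; ext i; simp [toReal_coe_mul]
  ext z
  constructor
  · rintro ⟨y, ⟨hy, hA⟩, rfl⟩
    refine ⟨scale_mem_finitePart t hy, ?_⟩
    rw [hgt t ht, inv_mul_cancel_left₀ ht.ne']
    exact hA
  · rintro ⟨hz, hA⟩
    refine ⟨fun i => ((t⁻¹ : ℝ) : EReal) * z i, ⟨scale_mem_finitePart t⁻¹ hz, ?_⟩, ?_⟩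
    · rw [hgt _ (inv_pos.2 ht)]; exact hA
    · ext i
      simp only
      rw [← mul_assoc, ← EReal.coe_mul, mul_inv_cancel₀ ht.ne']
      simp

variable {α : ℝ}

/-- A homogeneous measure does not charge infinite coordinates: `{y | y i = ±∞}` is invariant under
scaling, has finite mass, and its mass is multiplied by `2 ^ (-α) < 1`. -/
theorem measure_compl_finitePart (hα : 0 < α) (hμ : IsNonnullRadonPunctured μ)
    (hh : IsHomogeneousMeasure μ α) : μ (finitePart d)ᶜ = 0 := by
  have key : ∀ (i : Fin d) (e : EReal), (∀ t : ℝ, 0 < t → (t : EReal) * e = e) → e ≠ 0 →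
      μ {y | y i = e} = 0 := by
    intro i e he he0
    have hcl : IsClosed {y : Fin d → EReal | y i = e} :=
      isClosed_eq (continuous_apply i) continuous_const
    have hf : μ {y | y i = e} < ⊤ := by
      have := hμ.finite_away {y | y i = e}ᶜ (hcl.isOpen_compl.mem_nhds (by simpa using he0.symm))
      simpa using this
    have h2 := hh 2 two_pos _ hcl.measurableSet
    have him : (fun (y : Fin d → EReal) i => ((2 : ℝ) : EReal) * y i) '' {y | y i = e} =
        {y | y i = e} := by
      ext z
      constructor
      · rintro ⟨y, hy, rfl⟩
        simp only [Set.mem_ofPred_eq] at hy ⊢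
        rw [hy, he 2 two_pos]
      · intro hz
        refine ⟨fun j => (((2 : ℝ)⁻¹ : ℝ) : EReal) * z j, ?_, ?_⟩
        · simp only [Set.mem_ofPred_eq] at hz ⊢
          rw [hz, he _ (by norm_num)]
        · ext j
          simp only
          rw [← mul_assoc, ← EReal.coe_mul, mul_inv_cancel₀ two_ne_zero]
          simp
    rw [him] at h2
    by_contra h0
    have hlt : ENNReal.ofReal ((2 : ℝ) ^ (-α)) < 1 := by
      rw [ENNReal.ofReal_lt_one]
      exact Real.rpow_lt_one_of_one_lt_of_neg one_lt_two (by linarith)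
    have := ENNReal.mul_lt_mul_left h0 hf.ne hlt
    rw [one_mul, ← h2] at this
    exact lt_irrefl _ this
  have : (finitePart d)ᶜ ⊆ ⋃ i, ({y | y i = ⊥} ∪ {y | y i = ⊤}) := by
    intro y hy
    simp only [finitePart, Set.mem_compl_iff, Set.mem_ofPred_eq, not_forall] at hy
    obtain ⟨i, hi⟩ := hy
    simp only [Set.mem_iUnion]
    exact ⟨i, by by_contra hc; simp at hc; exact hi hc⟩
  refine measure_mono_null this (measure_iUnion_null fun i => measure_union_null ?_ ?_)
  · exact key i ⊥ (fun _ ht => EReal.coe_mul_bot_of_pos ht) (by simp)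
  · exact key i ⊤ (fun _ ht => EReal.coe_mul_top_of_pos ht) (by simp)

section homog
variable {g : (Fin d → ℝ) → ℝ}

theorem lt_mem_nhds_zero (hgc : Continuous g)
    (hg : ∀ t : ℝ, 0 < t → ∀ x, g (t • x) = t * g x)
    {c : ℝ} (hc : 0 < c) :
    {y : Fin d → EReal | g (fun i => (y i).toReal) < c} ∈ 𝓝 0 := by
  have hg0 : g 0 = 0 := by
    have := hg 2 two_pos 0
    rw [smul_zero] at this
    linarith
  have h1 : ContinuousAt (fun y : Fin d → EReal => g (fun i => (y i).toReal)) 0 :=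
    hgc.continuousAt.comp (continuousOn_toReal_finitePart.continuousAt
      ((isOpen_finitePart d).mem_nhds zero_mem_finitePart))
  refine h1.eventually_lt continuousAt_const ?_
  simpa [← Pi.zero_def, hg0] using hc

theorem measurableSet_homog (hgc : Continuous g) {A : Set ℝ} (hA : MeasurableSet A) :
    MeasurableSet {y : Fin d → EReal | y ∈ finitePart d ∧ g (fun i => (y i).toReal) ∈ A} := by
  refine (isOpen_finitePart d).measurableSet.inter ?_
  exact (hgc.measurable.comp (measurable_pi_lambda _ fun i =>
    measurable_ereal_toReal.comp (measurable_pi_apply i))) hA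

/-- The level sets of a positively homogeneous function are not charged by a homogeneous measure:
uncountably many of them, of comparable mass, fit in a set of finite measure. -/
theorem measure_level_eq_zero (hgc : Continuous g)
    (hg : ∀ t : ℝ, 0 < t → ∀ x, g (t • x) = t * g x)
    (hμ : IsNonnullRadonPunctured μ)
    (hh : IsHomogeneousMeasure μ α) {c : ℝ} (hc : 0 < c) :
    μ {y | y ∈ finitePart d ∧ g (fun i => (y i).toReal) ∈ ({c} : Set ℝ)} = 0 := by
  by_contra h0
  have hms := fun r : ℝ => measurableSet_homog hgc (measurableSet_singleton r)
  have hcount := Measure.countable_meas_pos_of_disjoint_of_meas_iUnion_ne_top μ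
    (As := fun r : Set.Ici c =>
      {y : Fin d → EReal | y ∈ finitePart d ∧ g (fun i => (y i).toReal) ∈ ({(r : ℝ)} : Set ℝ)})
    (fun r => hms r) (by
      intro r s hrs
      refine Set.disjoint_left.2 ?_
      rintro y ⟨_, h1⟩ ⟨_, h2⟩
      exact hrs (Subtype.ext (h1.symm.trans h2)))
    (by
      refine ne_top_of_le_ne_top
        (hμ.finite_away _ (lt_mem_nhds_zero hgc hg hc)).ne (measure_mono ?_)
      refine Set.iUnion_subset fun r => ?_
      rintro y ⟨_, h1⟩
      simp only [Set.mem_compl_iff, Set.mem_ofPred_eq, not_lt]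
      rw [h1]; exact r.2)
  have hall : {i : Set.Ici c | 0 < μ {y : Fin d → EReal | y ∈ finitePart d ∧
      g (fun i => (y i).toReal) ∈ ({(i : ℝ)} : Set ℝ)}} = Set.univ := by
    refine Set.eq_univ_of_forall fun r => ?_
    have hr : 0 < (r : ℝ) := hc.trans_le r.2
    have := hh (r / c) (div_pos hr hc) _ (hms c)
    rw [image_scale_eq hg (div_pos hr hc)] at this
    have hset : {y : Fin d → EReal | y ∈ finitePart d ∧
        ((r : ℝ) / c)⁻¹ * g (fun i => (y i).toReal) ∈ ({c} : Set ℝ)} =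
        {y | y ∈ finitePart d ∧ g (fun i => (y i).toReal) ∈ ({(r : ℝ)} : Set ℝ)} := by
      ext y
      simp only [Set.mem_ofPred_eq, Set.mem_singleton_iff]
      refine and_congr_right fun _ => ?_
      rw [inv_mul_eq_iff_eq_mul₀ (div_pos hr hc).ne', div_mul_cancel₀ _ hc.ne']
    rw [hset] at this
    simp only [Set.mem_ofPred_eq]
    rw [this]
    refine ENNReal.mul_pos ?_ h0
    simpa using Real.rpow_pos_of_pos (div_pos hr hc) _
  rw [hall, Set.countable_univ_iff] at hcount
  have h1 := Cardinal.mk_le_aleph0_iff.2 hcount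
  rw [Cardinal.mk_Ici_real] at h1
  exact absurd h1 (not_le.2 Cardinal.aleph0_lt_continuum)

theorem measure_frontier_eq_zero (hgc : Continuous g)
    (hg : ∀ t : ℝ, 0 < t → ∀ x, g (t • x) = t * g x)
    (hα : 0 < α) (hμ : IsNonnullRadonPunctured μ)
    (hh : IsHomogeneousMeasure μ α) {c : ℝ} (hc : 0 < c) :
    μ (frontier {y | y ∈ finitePart d ∧ g (fun i => (y i).toReal) ∈ Set.Ioi c}) = 0 := by
  have hcont : ContinuousOn (fun y : Fin d → EReal => g (fun i => (y i).toReal)) (finitePart d) :=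
    hgc.comp_continuousOn continuousOn_toReal_finitePart
  have hopen : IsOpen {y | y ∈ finitePart d ∧ g (fun i => (y i).toReal) ∈ Set.Ioi c} :=
    hcont.isOpen_inter_preimage (isOpen_finitePart d) isOpen_Ioi
  refine measure_mono_null (t := (finitePart d)ᶜ ∪
    {y | y ∈ finitePart d ∧ g (fun i => (y i).toReal) ∈ ({c} : Set ℝ)}) ?_
    (measure_union_null (measure_compl_finitePart hα hμ hh)
      (measure_level_eq_zero hgc hg hμ hh hc))
  intro y hy
  rw [hopen.frontier_eq] at hy
  by_cases hyU : y ∈ finitePart d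
  · refine Or.inr ⟨hyU, ?_⟩
    have h1 : ¬ c < g (fun i => (y i).toReal) := fun h => hy.2 ⟨hyU, h⟩
    refine le_antisymm (not_lt.1 h1) ?_
    by_contra hlt
    have hopen' : IsOpen (finitePart d ∩
        (fun y : Fin d → EReal => g (fun i => (y i).toReal)) ⁻¹' Set.Iio c) :=
      hcont.isOpen_inter_preimage (isOpen_finitePart d) isOpen_Iio
    obtain ⟨z, ⟨_, hz1⟩, ⟨_, hz2⟩⟩ := mem_closure_iff.1 hy.1 _ hopen' ⟨hyU, not_le.1 hlt⟩
    exact lt_asymm (Set.mem_Ioi.1 hz2) (Set.mem_Iio.1 hz1)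
  · exact Or.inl hyU

/-- For a continuous positively homogeneous `g`, the tail of `g (X_1, …, X_d)` along the
normalizing sequence is asymptotically a power. -/
theorem VagueLimit.tendsto_homog (hgc : Continuous g)
    (hg : ∀ t : ℝ, 0 < t → ∀ x, g (t • x) = t * g x)
    (hX : ∀ t, Measurable (X t)) (ha : ∀ n, 0 < a n) (hα : 0 < α)
    (hμ : IsNonnullRadonPunctured μ)
    (hh : IsHomogeneousMeasure μ α) (hv : VagueLimit P X a d μ) :
    ∃ τ : ℝ, ∀ c : ℝ, 0 < c → Tendsto (fun n : ℕ => (n : ℝ) * P.real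
      {ω | c * a n < g (fun i : Fin d => X ((i : ℤ) + 1) ω)}) atTop (𝓝 (c ^ (-α) * τ)) := by
  refine ⟨μ.real {y | y ∈ finitePart d ∧ g (fun i => (y i).toReal) ∈ Set.Ioi 1}, fun c hc => ?_⟩
  have h1 := hv.tendsto_measureReal hX hμ (measurableSet_homog hgc measurableSet_Ioi)
    (lt_mem_nhds_zero hgc hg hc) (by
      refine Set.disjoint_left.2 ?_
      rintro y ⟨_, hy⟩ hy'
      have h1 : g (fun i => (y i).toReal) < c := hy'
      exact lt_asymm (Set.mem_Ioi.1 hy) h1) (measure_frontier_eq_zero hgc hg hα hμ hh hc)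
  have h2 : μ.real {y | y ∈ finitePart d ∧ g (fun i => (y i).toReal) ∈ Set.Ioi c} = c ^ (-α) *
      μ.real {y | y ∈ finitePart d ∧ g (fun i => (y i).toReal) ∈ Set.Ioi 1} := by
    have := hh c hc _ (measurableSet_homog (d := d) hgc (measurableSet_Ioi (a := 1)))
    rw [image_scale_eq hg hc] at this
    have hset : {y : Fin d → EReal | y ∈ finitePart d ∧
        c⁻¹ * g (fun i => (y i).toReal) ∈ Set.Ioi 1} =
        {y | y ∈ finitePart d ∧ g (fun i => (y i).toReal) ∈ Set.Ioi c} := by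
      ext y
      simp only [Set.mem_ofPred_eq, Set.mem_Ioi]
      refine and_congr_right fun _ => ?_
      rw [lt_inv_mul_iff₀ hc, mul_one]
    rw [hset] at this
    rw [measureReal_def, this, ENNReal.toReal_mul,
      ENNReal.toReal_ofReal (Real.rpow_nonneg hc.le _), ← measureReal_def]
  rw [h2] at h1
  refine h1.congr fun n => ?_
  congr 2
  ext ω
  simp only [Set.mem_ofPred_eq, Set.mem_Ioi, EReal.toReal_coe]
  have hfin : (fun i : Fin d => (((a n)⁻¹ * X ((i : ℤ) + 1) ω : ℝ) : EReal)) ∈ finitePart d :=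
    fun i => ⟨EReal.coe_ne_bot _, EReal.coe_ne_top _⟩
  have := hg (a n)⁻¹ (inv_pos.2 (ha n)) (fun i : Fin d => X ((i : ℤ) + 1) ω)
  simp only [Pi.smul_def, smul_eq_mul] at this
  rw [this, lt_inv_mul_iff₀ (ha n), mul_comm (a n)]
  exact ⟨fun h => h.2, fun h => ⟨hfin, h⟩⟩

end homog
end

/-! ### Regularly varying tails -/

/-- If `n T(c aₙ) → c ^ (-α)` for all `c > 0`, then `T` never vanishes: otherwise `aₙ` would be
bounded, and `T(u) ≤ T(c aₙ) = O(1 / n)` for every `u > 0` and suitable `c`. -/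
theorem pos_of_tendsto_normalized {T : ℝ → ℝ} (hT : Antitone T) (hT0 : ∀ x, 0 ≤ T x) {α : ℝ}
    {a : ℕ → ℝ} (ha : ∀ n, 0 < a n)
    (h : ∀ c : ℝ, 0 < c → Tendsto (fun n : ℕ => (n : ℝ) * T (c * a n)) atTop (𝓝 (c ^ (-α))))
    (x : ℝ) : 0 < T x := by
  have h1 := h 1 one_pos
  simp only [one_mul, Real.one_rpow] at h1
  have hev : ∀ᶠ n : ℕ in atTop, 0 < T (a n) := by
    filter_upwards [h1.eventually (lt_mem_nhds one_half_lt_one)] with n hn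
    rcases (hT0 (a n)).lt_or_eq with h | h
    · exact h
    · rw [← h, mul_zero] at hn
      norm_num at hn
  by_contra hx
  have hx1 : T (max x 1) ≤ 0 := (hT (le_max_left x 1)).trans (not_lt.1 hx)
  have hm : (0 : ℝ) < max x 1 := by positivity
  have hz : ∀ u : ℝ, 0 < u → T u ≤ 0 := by
    intro u hu
    by_contra hTu
    rw [not_le] at hTu
    refine not_tendsto_atTop_of_tendsto_nhds (h (u / max x 1) (div_pos hu hm)) ?_
    refine tendsto_atTop_mono' _ ?_ (tendsto_natCast_atTop_atTop.atTop_mul_const hTu)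
    filter_upwards [hev] with n hn
    refine mul_le_mul_of_nonneg_left (hT ?_) (Nat.cast_nonneg n)
    have : a n ≤ max x 1 := by
      by_contra hc
      exact absurd ((hT (not_le.1 hc).le).trans hx1) (not_le.2 hn)
    rw [div_mul_eq_mul_div, div_le_iff₀ hm]
    exact mul_le_mul_of_nonneg_left this hu.le
  obtain ⟨n, hn⟩ := hev.exists
  exact absurd (hz (a n) (ha n)) (not_le.2 hn)

theorem tendsto_zero_of_tendsto_normalized {T : ℝ → ℝ} (hT : Antitone T) (hT0 : ∀ x, 0 ≤ T x)
    {α : ℝ} {a : ℕ → ℝ}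
    (h : ∀ c : ℝ, 0 < c → Tendsto (fun n : ℕ => (n : ℝ) * T (c * a n)) atTop (𝓝 (c ^ (-α)))) :
    Tendsto T atTop (𝓝 0) := by
  have h1 := h 1 one_pos
  simp only [one_mul, Real.one_rpow] at h1
  have h2 : Tendsto (fun n : ℕ => T (a n)) atTop (𝓝 0) := by
    have := (tendsto_inv_atTop_nhds_zero_nat (𝕜 := ℝ)).mul h1
    rw [zero_mul] at this
    refine this.congr' ?_
    filter_upwards [eventually_gt_atTop 0] with n hn
    have : (n : ℝ) ≠ 0 := by positivity
    field_simp
  rw [tendsto_order]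
  refine ⟨fun b hb => Eventually.of_forall fun x => hb.trans_le (hT0 x), fun b hb => ?_⟩
  obtain ⟨n, hn⟩ := (h2.eventually (gt_mem_nhds hb)).exists
  filter_upwards [eventually_ge_atTop (a n)] with x hx
  exact (hT hx).trans_lt hn

/-- Passage from the normalizing sequence to a continuous level `x`: the index `⌊1 / T x⌋` is the
one whose normalizing constant is comparable with `x`. -/
theorem tendsto_div_of_tendsto_normalized {T F : ℝ → ℝ} (hT : Antitone T) (hT0 : ∀ x, 0 ≤ T x)
    (hF : Antitone F) {α τ : ℝ} (hα : 0 < α) {a : ℕ → ℝ} (ha : ∀ n, 0 < a n)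
    (h : ∀ c : ℝ, 0 < c → Tendsto (fun n : ℕ => (n : ℝ) * T (c * a n)) atTop (𝓝 (c ^ (-α))))
    (h' : ∀ c : ℝ, 0 < c →
      Tendsto (fun n : ℕ => (n : ℝ) * F (c * a n)) atTop (𝓝 (c ^ (-α) * τ))) :
    Tendsto (fun x => F x / T x) atTop (𝓝 τ) := by
  have hTpos := pos_of_tendsto_normalized hT hT0 ha h
  have hTlim := tendsto_zero_of_tendsto_normalized hT hT0 h
  set N : ℝ → ℕ := fun x => ⌊(T x)⁻¹⌋₊ with hN
  have hinv : Tendsto (fun x => (T x)⁻¹) atTop atTop :=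
    tendsto_inv_nhdsGT_zero.comp
      (tendsto_nhdsWithin_iff.2 ⟨hTlim, Eventually.of_forall fun x => hTpos x⟩)
  have hNlim : Tendsto N atTop atTop := tendsto_nat_floor_atTop.comp hinv
  have hNT : Tendsto (fun x => (N x : ℝ) * T x) atTop (𝓝 1) := by
    have := (tendsto_nat_floor_div_atTop (R := ℝ)).comp hinv
    refine this.congr fun x => ?_
    simp [hN, div_inv_eq_mul]
  have hcomp : ∀ c : ℝ, 0 < c →
      Tendsto (fun x => (N x : ℝ) * T (c * a (N x))) atTop (𝓝 (c ^ (-α))) :=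
    fun c hc => (h c hc).comp hNlim
  have hcomp' : ∀ c : ℝ, 0 < c →
      Tendsto (fun x => (N x : ℝ) * F (c * a (N x))) atTop (𝓝 (c ^ (-α) * τ)) :=
    fun c hc => (h' c hc).comp hNlim
  have hlow : ∀ c : ℝ, 0 < c → c < 1 → ∀ᶠ x in atTop, c * a (N x) ≤ x := by
    intro c hc hc1
    have : (1 : ℝ) < c ^ (-α) :=
      Real.one_lt_rpow_of_pos_of_lt_one_of_neg hc hc1 (by linarith)
    filter_upwards [hNT.eventually_lt (hcomp c hc) this] with x hx
    by_contra hlt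
    exact absurd hx (not_lt.2
      (mul_le_mul_of_nonneg_left (hT (not_le.1 hlt).le) (Nat.cast_nonneg _)))
  have hupp : ∀ c : ℝ, 1 < c → ∀ᶠ x in atTop, x ≤ c * a (N x) := by
    intro c hc
    have : c ^ (-α) < (1 : ℝ) := Real.rpow_lt_one_of_one_lt_of_neg hc (by linarith)
    filter_upwards [(hcomp c (by linarith)).eventually_lt hNT this] with x hx
    by_contra hlt
    exact absurd hx (not_lt.2
      (mul_le_mul_of_nonneg_left (hT (not_le.1 hlt).le) (Nat.cast_nonneg _)))
  have hcont : Tendsto (fun c : ℝ => c ^ (-α) * τ) (𝓝 1) (𝓝 τ) := by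
    have : ContinuousAt (fun c : ℝ => c ^ (-α) * τ) 1 :=
      (Real.continuousAt_rpow_const 1 (-α) (Or.inl one_ne_zero)).mul continuousAt_const
    simpa [ContinuousAt] using this
  have hNF : Tendsto (fun x => (N x : ℝ) * F x) atTop (𝓝 τ) := by
    rw [tendsto_order]
    constructor
    · intro b hb
      obtain ⟨c, hcb, hc1⟩ := (((hcont.mono_left nhdsWithin_le_nhds).eventually
        (lt_mem_nhds hb)).and (self_mem_nhdsWithin (s := Set.Ioi 1))).exists
      have hc1 : 1 < c := hc1
      filter_upwards [(hcomp' c (by linarith)).eventually (lt_mem_nhds hcb), hupp c hc1]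
        with x h1 h2
      exact h1.trans_le (mul_le_mul_of_nonneg_left (hF h2) (Nat.cast_nonneg _))
    · intro b hb
      obtain ⟨c, ⟨hcb, hc0⟩, hc1⟩ := ((((hcont.mono_left nhdsWithin_le_nhds).eventually
        (gt_mem_nhds hb)).and (mem_nhdsWithin_of_mem_nhds (lt_mem_nhds one_pos))).and
        (self_mem_nhdsWithin (s := Set.Iio 1))).exists
      have hc1 : c < 1 := hc1
      filter_upwards [(hcomp' c hc0).eventually (gt_mem_nhds hcb), hlow c hc0 hc1]
        with x h1 h2
      exact (mul_le_mul_of_nonneg_left (hF h2) (Nat.cast_nonneg _)).trans_lt h1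
  have := hNF.div hNT one_ne_zero
  rw [div_one] at this
  refine this.congr' ?_
  filter_upwards [hNlim.eventually (eventually_gt_atTop 0)] with x hx
  have h1 : (N x : ℝ) ≠ 0 := by positivity
  simp only [Pi.div_apply]
  rw [mul_div_mul_left _ _ h1]

/-- Induction along `x ↦ 2 x`, started on the interval `[x₀, 2 x₀]`. -/
theorem doubling_induction {Q : ℝ → Prop} {x₀ : ℝ} (hx₀ : 0 < x₀)
    (h0 : ∀ x, x₀ ≤ x → x ≤ 2 * x₀ → Q x) (h : ∀ x, x₀ ≤ x → Q x → Q (2 * x)) (x : ℝ)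
    (hx : x₀ ≤ x) : Q x := by
  have key : ∀ n : ℕ, ∀ x, x₀ ≤ x → x ≤ 2 ^ n * x₀ → Q x := by
    intro n
    induction n with
    | zero =>
      intro x h1 h2
      exact h0 x h1 (by linarith)
    | succ n ih =>
      intro x h1 h2
      by_cases h3 : x ≤ 2 * x₀
      · exact h0 x h1 h3
      · have := h (x / 2) (by linarith) (ih (x / 2) (by linarith) (by
          rw [pow_succ] at h2; linarith))
        rwa [mul_div_cancel₀ _ (two_ne_zero)] at this
  obtain ⟨n, hn⟩ := pow_unbounded_of_one_lt (x / x₀) (one_lt_two (α := ℝ))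
  exact key n x hx ((div_lt_iff₀ hx₀).1 hn).le

/-- A regularly varying tail of index `-α` is `O(x^(-β))` for every `β < α`. -/
theorem exists_le_rpow {T : ℝ → ℝ} (hT1 : ∀ x, T x ≤ 1) (hTpos : ∀ x, 0 < T x)
    {α β : ℝ} (hβ : 0 < β) (hβα : β < α)
    (h : ∀ c : ℝ, 0 < c → Tendsto (fun x => T (c * x) / T x) atTop (𝓝 (c ^ (-α)))) :
    ∃ C : ℝ, 0 < C ∧ ∀ x, 0 < x → T x ≤ C * x ^ (-β) := by
  have h2 : (2 : ℝ) ^ (-α) < 2 ^ (-β) :=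
    Real.rpow_lt_rpow_of_exponent_lt one_lt_two (by linarith)
  obtain ⟨x₁, hx₁⟩ := eventually_atTop.1 ((h 2 two_pos).eventually (gt_mem_nhds h2))
  set x₀ := max x₁ 1
  have hx₀ : 0 < x₀ := by positivity
  have key : ∀ x, x₀ ≤ x → T x * x ^ β ≤ (2 * x₀) ^ β := by
    refine doubling_induction hx₀ ?_ ?_
    · intro x h1 h3
      calc T x * x ^ β ≤ 1 * x ^ β :=
            mul_le_mul_of_nonneg_right (hT1 x) (Real.rpow_nonneg (hx₀.le.trans h1) _)
        _ ≤ _ := by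
            rw [one_mul]
            exact Real.rpow_le_rpow (hx₀.le.trans h1) h3 hβ.le
    · intro x h1 h3
      have hxpos : 0 < x := hx₀.trans_le h1
      have h4 := (div_lt_iff₀ (hTpos x)).1 (hx₁ x ((le_max_left _ _).trans h1))
      refine le_trans ?_ h3
      rw [Real.mul_rpow two_pos.le hxpos.le]
      have h5 : (2 : ℝ) ^ (-β) * 2 ^ β = 1 := by
        rw [← Real.rpow_add two_pos]; simp
      have h6 : 0 < (2 : ℝ) ^ β := by positivity
      have h7 : 0 < x ^ β := by positivity
      calc T (2 * x) * (2 ^ β * x ^ β) ≤ (2 ^ (-β) * T x) * (2 ^ β * x ^ β) := by gcongr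
        _ = (2 ^ (-β) * 2 ^ β) * (T x * x ^ β) := by ring
        _ = _ := by rw [h5, one_mul]
  refine ⟨(2 * x₀) ^ β, by positivity, fun x hx => ?_⟩
  rw [Real.rpow_neg hx.le, ← div_eq_mul_inv, le_div_iff₀ (by positivity)]
  rcases le_total x₀ x with h1 | h1
  · exact key x h1
  · calc T x * x ^ β ≤ 1 * x ^ β := by
          gcongr
          exact hT1 x
      _ ≤ _ := by
          rw [one_mul]
          exact Real.rpow_le_rpow hx.le (by linarith) hβ.le

/-- A regularly varying tail of index `-α` dominates `x^(-ρ)` for every `ρ > α`. -/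
theorem exists_rpow_le {T : ℝ → ℝ} (hT : Antitone T) (hTpos : ∀ x, 0 < T x)
    {α ρ : ℝ} (hρ : 0 < ρ) (hρα : α < ρ)
    (h : ∀ c : ℝ, 0 < c → Tendsto (fun x => T (c * x) / T x) atTop (𝓝 (c ^ (-α)))) :
    ∃ C x₀ : ℝ, 0 < C ∧ 0 < x₀ ∧ ∀ x, x₀ ≤ x → C * x ^ (-ρ) ≤ T x := by
  have h2 : (2 : ℝ) ^ (-ρ) < 2 ^ (-α) :=
    Real.rpow_lt_rpow_of_exponent_lt one_lt_two (by linarith)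
  obtain ⟨x₁, hx₁⟩ := eventually_atTop.1 ((h 2 two_pos).eventually (lt_mem_nhds h2))
  set x₀ := max x₁ 1
  have hx₀ : 0 < x₀ := by positivity
  have key : ∀ x, x₀ ≤ x → T (2 * x₀) * x₀ ^ ρ ≤ T x * x ^ ρ := by
    refine doubling_induction hx₀ ?_ ?_
    · intro x h1 h3
      have := hTpos x
      exact mul_le_mul (hT h3) (Real.rpow_le_rpow hx₀.le h1 hρ.le) (by positivity) this.le
    · intro x h1 h3
      have hxpos : 0 < x := hx₀.trans_le h1
      have h4 := (lt_div_iff₀ (hTpos x)).1 (hx₁ x ((le_max_left _ _).trans h1))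
      refine h3.trans ?_
      rw [Real.mul_rpow two_pos.le hxpos.le]
      have h5 : (2 : ℝ) ^ (-ρ) * 2 ^ ρ = 1 := by
        rw [← Real.rpow_add two_pos]; simp
      have h6 : 0 < (2 : ℝ) ^ ρ := by positivity
      have h7 : 0 < x ^ ρ := by positivity
      calc T x * x ^ ρ = (2 ^ (-ρ) * 2 ^ ρ) * (T x * x ^ ρ) := by rw [h5, one_mul]
        _ = (2 ^ (-ρ) * T x) * (2 ^ ρ * x ^ ρ) := by ring
        _ ≤ _ := by gcongr
  refine ⟨T (2 * x₀) * x₀ ^ ρ, x₀, mul_pos (hTpos _) (by positivity), hx₀, fun x hx => ?_⟩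
  have hxpos : 0 < x := hx₀.trans_le hx
  rw [Real.rpow_neg hxpos.le, ← div_eq_mul_inv, div_le_iff₀ (by positivity)]
  exact key x hx

theorem integrable_rpow_abs_of_tail_le {Ω : Type*} [MeasurableSpace Ω] {P : Measure Ω}
    [IsProbabilityMeasure P] {Y : Ω → ℝ} (hY : Measurable Y) {C β β' : ℝ} (hβ : 0 < β)
    (hββ' : β < β') (h : ∀ x, 0 < x → P.real {ω | x < |Y ω|} ≤ C * x ^ (-β')) :
    Integrable (fun ω => |Y ω| ^ β) P := by
  refine ⟨(hY.abs.pow_const β).aestronglyMeasurable, ?_⟩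
  rw [hasFiniteIntegral_iff_ofReal (Eventually.of_forall fun ω => by positivity)]
  rw [lintegral_rpow_eq_lintegral_meas_lt_mul P (Eventually.of_forall fun ω => abs_nonneg _)
    hY.abs.aemeasurable hβ]
  refine ENNReal.mul_lt_top ENNReal.ofReal_lt_top ?_
  rw [← Set.Ioc_union_Ioi_eq_Ioi (zero_le_one (α := ℝ))]
  refine (lintegral_union_le _ _ _).trans_lt (ENNReal.add_lt_top.2 ⟨?_, ?_⟩)
  · have hi : IntegrableOn (fun t : ℝ => t ^ (β - 1)) (Set.Ioc 0 1) :=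
      (intervalIntegral.intervalIntegrable_rpow' (by linarith)).1
    refine lt_of_le_of_lt (setLIntegral_mono' measurableSet_Ioc fun t _ => ?_)
      hi.lintegral_lt_top
    calc P {ω | t < |Y ω|} * ENNReal.ofReal (t ^ (β - 1))
        ≤ 1 * ENNReal.ofReal (t ^ (β - 1)) := by gcongr; exact prob_le_one
      _ = _ := one_mul _
  · have hi : IntegrableOn (fun t : ℝ => C * t ^ (β - β' - 1)) (Set.Ioi 1) :=
      (integrableOn_Ioi_rpow_of_lt (by linarith) one_pos).const_mul C
    refine lt_of_le_of_lt (setLIntegral_mono' measurableSet_Ioi fun t ht => ?_)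
      hi.lintegral_lt_top
    have ht0 : (0 : ℝ) < t := one_pos.trans ht
    rw [← ofReal_measureReal, ← ENNReal.ofReal_mul measureReal_nonneg]
    refine ENNReal.ofReal_le_ofReal ?_
    calc P.real {ω | t < |Y ω|} * t ^ (β - 1) ≤ (C * t ^ (-β')) * t ^ (β - 1) := by
          gcongr
          exact h t ht0
      _ = C * t ^ (β - β' - 1) := by
          rw [mul_assoc, ← Real.rpow_add ht0]
          ring_nf

/-! ### Exponential bounds for sums of truncated variables -/

/-- The truncation `y 𝟙(|y| ≤ L)`. -/
noncomputable def trunc (L y : ℝ) : ℝ := if |y| ≤ L then y else 0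

theorem measurable_trunc (L : ℝ) : Measurable (trunc L) :=
  Measurable.ite (measurableSet_le measurable_id.abs measurable_const) measurable_id
    measurable_const

theorem abs_trunc_le {L : ℝ} (hL : 0 ≤ L) (y : ℝ) : |trunc L y| ≤ L := by
  unfold trunc
  split_ifs with h
  · exact h
  · simpa using hL

theorem exp_le_one_add_add_sq_mul_exp (u : ℝ) :
    Real.exp u ≤ 1 + u + u ^ 2 * Real.exp |u| := by
  have h := Complex.norm_exp_sub_sum_le_norm_mul_exp (u : ℂ) 2
  have e : Complex.exp (u : ℂ) - ∑ m ∈ Finset.range 2, (u : ℂ) ^ m / (m.factorial : ℂ) =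
      ((Real.exp u - (1 + u) : ℝ) : ℂ) := by
    simp [Finset.sum_range_succ]
  rw [e, Complex.norm_real, Complex.norm_real, Real.norm_eq_abs, Real.norm_eq_abs, sq_abs] at h
  linarith [le_abs_self (Real.exp u - (1 + u))]

section
variable {Ω : Type*} [MeasurableSpace Ω] {P : Measure Ω} [IsProbabilityMeasure P]

theorem mgf_le_exp_of_bounded {Y : Ω → ℝ} (hY : Measurable Y) {L : ℝ} (hL : ∀ ω, |Y ω| ≤ L)
    (t : ℝ) : mgf Y P t ≤
      Real.exp (|t| * |∫ ω, Y ω ∂P| + t ^ 2 * (∫ ω, Y ω ^ 2 ∂P) * Real.exp (|t| * L)) := by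
  have hYi : Integrable Y P := Integrable.of_bound hY.aestronglyMeasurable L
    (Eventually.of_forall hL)
  have hY2 : Integrable (fun ω => Y ω ^ 2) P :=
    Integrable.of_bound (hY.pow_const 2).aestronglyMeasurable (L ^ 2)
      (Eventually.of_forall fun ω => by
        rw [Real.norm_eq_abs, abs_pow]
        exact pow_le_pow_left₀ (abs_nonneg _) (hL ω) 2)
  have hb : ∀ ω, Real.exp (t * Y ω) ≤
      1 + t * Y ω + t ^ 2 * Y ω ^ 2 * Real.exp (|t| * L) := fun ω => by
    refine (exp_le_one_add_add_sq_mul_exp _).trans ?_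
    rw [mul_pow, abs_mul]
    have := hL ω
    gcongr
  have hint : Integrable (fun ω => 1 + t * Y ω + t ^ 2 * Y ω ^ 2 * Real.exp (|t| * L)) P :=
    (((integrable_const _).add (hYi.const_mul t)).add ((hY2.const_mul _).mul_const _))
  calc mgf Y P t ≤ ∫ ω, (1 + t * Y ω + t ^ 2 * Y ω ^ 2 * Real.exp (|t| * L)) ∂P := by
        refine integral_mono_of_nonneg (Eventually.of_forall fun ω => (Real.exp_pos _).le) hint
          (Eventually.of_forall hb)
    _ = 1 + t * (∫ ω, Y ω ∂P) + t ^ 2 * (∫ ω, Y ω ^ 2 ∂P) * Real.exp (|t| * L) := by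
        rw [integral_add (f := fun ω => 1 + t * Y ω) ((integrable_const _).add (hYi.const_mul t))
          ((hY2.const_mul _).mul_const _), integral_add (integrable_const _) (hYi.const_mul t),
          integral_const_mul, integral_mul_const, integral_const_mul]
        simp
    _ ≤ 1 + (|t| * |∫ ω, Y ω ∂P| + t ^ 2 * (∫ ω, Y ω ^ 2 ∂P) * Real.exp (|t| * L)) := by
        rw [← abs_mul]
        linarith [le_abs_self (t * ∫ ω, Y ω ∂P)]
    _ ≤ _ := by
        rw [add_comm]
        exact Real.add_one_le_exp _

theorem rpow_le_rpow_sub_mul {y L β p : ℝ} (hy : 0 ≤ y) (hyL : y ≤ L) (hβ : 0 < β) (hp : 0 < p)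
    (hβp : β ≤ p) : y ^ p ≤ L ^ (p - β) * y ^ β := by
  rcases hy.eq_or_lt with rfl | hy
  · rw [Real.zero_rpow hp.ne', Real.zero_rpow hβ.ne', mul_zero]
  · calc y ^ p = y ^ (p - β) * y ^ β := by rw [← Real.rpow_add hy]; ring_nf
      _ ≤ _ := by
        gcongr

omit [IsProbabilityMeasure P] in
theorem integral_trunc_sq_le {Y : Ω → ℝ} {L β : ℝ} (hL : 0 < L) (hβ : 0 < β)
    (hβ2 : β ≤ 2) (hi : Integrable (fun ω => |Y ω| ^ β) P) :
    ∫ ω, trunc L (Y ω) ^ 2 ∂P ≤ L ^ (2 - β) * ∫ ω, |Y ω| ^ β ∂P := by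
  rw [← integral_const_mul]
  refine integral_mono_of_nonneg (Eventually.of_forall fun ω => sq_nonneg _) (hi.const_mul _)
    (Eventually.of_forall fun ω => ?_)
  simp only [trunc]
  split_ifs with h
  · rw [← sq_abs, ← Real.rpow_natCast]
    exact_mod_cast rpow_le_rpow_sub_mul (abs_nonneg _) h hβ two_pos hβ2
  · simp only [ne_eq, OfNat.ofNat_ne_zero, not_false_eq_true, zero_pow]
    positivity

theorem integrable_trunc {Y : Ω → ℝ} (hY : Measurable Y) {L : ℝ} (hL : 0 < L) :
    Integrable (fun ω => trunc L (Y ω)) P :=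
  Integrable.of_bound ((measurable_trunc L).comp hY).aestronglyMeasurable L
    (Eventually.of_forall fun _ => abs_trunc_le hL.le _)

/-- The mean of the truncated variable is small: below exponent one because the truncated part
itself is small, from exponent one on because the mean vanishes and the removed part is small. -/
theorem abs_integral_trunc_le {Y : Ω → ℝ} (hY : Measurable Y) {L β : ℝ} (hL : 0 < L) (hβ : 0 < β)
    (hi : Integrable (fun ω => |Y ω| ^ β) P) (hmean : Integrable Y P → ∫ ω, Y ω ∂P = 0) :
    |∫ ω, trunc L (Y ω) ∂P| ≤ L ^ (1 - β) * ∫ ω, |Y ω| ^ β ∂P := by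
  have hti : Integrable (fun ω => trunc L (Y ω)) P := integrable_trunc hY hL
  rcases lt_or_ge β 1 with h1 | h1
  · rw [← integral_const_mul]
    refine abs_integral_le_integral_abs.trans ?_
    refine integral_mono hti.abs (hi.const_mul _) fun ω => ?_
    simp only [trunc]
    split_ifs with h
    · have := rpow_le_rpow_sub_mul (abs_nonneg (Y ω)) h hβ one_pos h1.le
      rwa [Real.rpow_one] at this
    · rw [abs_zero]; positivity
  · have hYi : Integrable Y P := by
      refine ((integrable_const 1).add hi).mono' hY.aestronglyMeasurable
        (Eventually.of_forall fun ω => ?_)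
      simp only [Real.norm_eq_abs, Pi.add_apply]
      rcases le_total |Y ω| 1 with h | h
      · have : 0 ≤ |Y ω| ^ β := by positivity
        linarith
      · have := Real.rpow_le_rpow_of_exponent_le h h1
        rw [Real.rpow_one] at this
        linarith
    have e : ∫ ω, trunc L (Y ω) ∂P = ∫ ω, (trunc L (Y ω) - Y ω) ∂P := by
      rw [integral_sub hti hYi, hmean hYi, sub_zero]
    rw [e, ← integral_const_mul]
    refine abs_integral_le_integral_abs.trans ?_
    refine integral_mono (hti.sub hYi).abs (hi.const_mul _) fun ω => ?_
    simp only [trunc]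
    split_ifs with h
    · rw [sub_self, abs_zero]; positivity
    · rw [zero_sub, abs_neg]
      have h := not_le.1 h
      have hpos : 0 < |Y ω| := hL.trans h
      calc |Y ω| = |Y ω| ^ (1 - β) * |Y ω| ^ β := by
            rw [← Real.rpow_add hpos]; simp
        _ ≤ _ := by
            refine mul_le_mul_of_nonneg_right ?_ (by positivity)
            exact Real.rpow_le_rpow_of_nonpos hL h.le (by linarith)

variable {X : ℤ → Ω → ℝ}

/-- The sum of the truncated variables with indices in `{1, …, n}` congruent to `r` modulo `D`. -/
noncomputable def residueSum (X : ℤ → Ω → ℝ) (D : ℕ) (L : ℝ) (r n : ℕ) (ω : Ω) : ℝ :=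
  ∑ i ∈ Finset.Icc 1 n with i % D = r, trunc L (X (i : ℤ) ω)

/-- The sum of the truncated variables with indices in `{1, …, n}`. -/
noncomputable def smallSum (X : ℤ → Ω → ℝ) (L : ℝ) (n : ℕ) (ω : Ω) : ℝ :=
  ∑ i ∈ Finset.Icc 1 n, trunc L (X (i : ℤ) ω)

theorem measurable_residueSum (hX : ∀ t, Measurable (X t)) (D : ℕ) (L : ℝ) (r n : ℕ) :
    Measurable (residueSum X D L r n) := by
  unfold residueSum
  exact Finset.measurable_fun_sum _ fun i _ => (measurable_trunc L).comp (hX _)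

omit [MeasurableSpace Ω] in
theorem abs_residueSum_le {D : ℕ} {L : ℝ} (hL : 0 ≤ L) (r n : ℕ) (ω : Ω) :
    |residueSum X D L r n ω| ≤ n * L := by
  refine (Finset.abs_sum_le_sum_abs _ _).trans ?_
  refine (Finset.sum_le_card_nsmul _ _ L fun i _ => abs_trunc_le hL _).trans ?_
  rw [nsmul_eq_mul]
  refine mul_le_mul_of_nonneg_right ?_ hL
  exact_mod_cast (Finset.card_filter_le _ _).trans (by simp)

omit [MeasurableSpace Ω] in
theorem residueSum_succ (D : ℕ) (L : ℝ) (r n : ℕ) :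
    residueSum X D L r (n + 1) = residueSum X D L r n +
      fun ω => if (n + 1) % D = r then trunc L (X ((n + 1 : ℕ) : ℤ) ω) else 0 := by
  ext ω
  simp only [residueSum, Pi.add_apply, Finset.sum_filter]
  rw [Finset.sum_Icc_succ_top (by omega)]

omit [IsProbabilityMeasure P] in
theorem indepFun_residueSum {m : ℕ} (hdep : IsMDependent P X m) (L : ℝ) (r n : ℕ)
    (hr : (n + 1) % (m + 1) = r) :
    IndepFun (residueSum X (m + 1) L r n) (fun ω => trunc L (X ((n + 1 : ℕ) : ℤ) ω)) P := by
  set t : ℤ := (n : ℤ) - m with ht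
  let φ : (Set.Iic t → ℝ) → ℝ := fun y => ∑ i ∈ Finset.Icc 1 n with i % (m + 1) = r,
    if h : (i : ℤ) ≤ t then trunc L (y ⟨i, h⟩) else 0
  have hφ : Measurable φ := by
    refine Finset.measurable_fun_sum _ fun i _ => ?_
    by_cases h : (i : ℤ) ≤ t
    · simp only [h, dite_true]
      exact (measurable_trunc L).comp (measurable_pi_apply _)
    · simp only [h, dite_false]
      exact measurable_const
  have hn : ((n + 1 : ℕ) : ℤ) ∈ Set.Ioi (t + (m : ℤ)) := by
    simp only [Set.mem_Ioi, ht]; push_cast; omega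
  have key := (hdep t).comp hφ
    ((measurable_trunc L).comp (measurable_pi_apply (⟨_, hn⟩ : Set.Ioi (t + (m : ℤ)))))
  suffices h : residueSum X (m + 1) L r n = φ ∘ fun ω (s : Set.Iic t) => X s ω by
    rw [h]; exact key
  ext ω
  simp only [residueSum, Function.comp, φ]
  refine Finset.sum_congr rfl fun i hi => ?_
  rw [Finset.mem_filter, Finset.mem_Icc] at hi
  have : (i : ℤ) ≤ t := by
    -- `i ≡ n + 1` modulo `m + 1` and `i < n + 1`
    have h1 : i % (m + 1) = (n + 1) % (m + 1) := hi.2.trans hr.symm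
    have h2 : (m + 1) ∣ (n + 1) - i := (Nat.modEq_iff_dvd' (by omega)).1 h1
    have h3 := Nat.le_of_dvd (by omega) h2
    omega
  simp only [this, dite_true]

theorem mgf_residueSum_le (hX : ∀ t, Measurable (X t)) {m : ℕ} (hdep : IsMDependent P X m)
    (hid : ∀ t, IdentDistrib (X t) (X 0) P P) (L t M : ℝ)
    (hM1 : 1 ≤ M) (hM : mgf (fun ω => trunc L (X 0 ω)) P t ≤ M) (r n : ℕ) :
    mgf (residueSum X (m + 1) L r n) P t ≤ M ^ n := by
  induction n with
  | zero =>
    have : residueSum X (m + 1) L r 0 = fun _ : Ω => (0 : ℝ) := by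
      ext ω; simp [residueSum]
    rw [this]
    simp [mgf]
  | succ n ih =>
    rw [residueSum_succ]
    by_cases hr : (n + 1) % (m + 1) = r
    · simp only [hr, if_true]
      rw [(indepFun_residueSum hdep L r n hr).mgf_add'
        (measurable_residueSum hX _ _ _ _).aestronglyMeasurable
        ((measurable_trunc L).comp (hX _)).aestronglyMeasurable, pow_succ]
      have e : mgf (fun ω => trunc L (X ((n + 1 : ℕ) : ℤ) ω)) P t =
          mgf (fun ω => trunc L (X 0 ω)) P t :=
        ((hid _).comp (u := fun y => Real.exp (t * trunc L y))
          (((measurable_trunc L).const_mul t).exp)).integral_eq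
      rw [e]
      exact mul_le_mul ih hM mgf_nonneg (by positivity)
    · simp only [hr, if_false]
      have : (residueSum X (m + 1) L r n + fun _ => (0 : ℝ)) = residueSum X (m + 1) L r n := by
        ext ω; simp
      rw [this]
      exact ih.trans (pow_le_pow_right₀ hM1 (Nat.le_succ n))

/-- Chernoff bound for the sum of the truncated variables, split into `m + 1` residue classes, each
a sum of independent variables. -/
theorem measureReal_abs_smallSum_ge_le (hX : ∀ t, Measurable (X t)) {m : ℕ}
    (hdep : IsMDependent P X m)
    (hid : ∀ t, IdentDistrib (X t) (X 0) P P) {L h M : ℝ} (hL : 0 ≤ L) (hh : 0 ≤ h)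
    (hM1 : 1 ≤ M) (hM : mgf (fun ω => trunc L (X 0 ω)) P h ≤ M)
    (hM' : mgf (fun ω => trunc L (X 0 ω)) P (-h) ≤ M) (n : ℕ) (u : ℝ) :
    P.real {ω | u ≤ |smallSum X L n ω|} ≤
      (m + 1) * (2 * (Real.exp (-h * (u / (m + 1))) * M ^ n)) := by
  have hD : (0 : ℝ) < m + 1 := by positivity
  set v := u / ((m : ℝ) + 1) with hv
  have hint : ∀ t : ℝ, ∀ r,
      Integrable (fun ω => Real.exp (t * residueSum X (m + 1) L r n ω)) P := by
    intro t r
    refine Integrable.of_bound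
      ((measurable_residueSum hX _ _ _ _).const_mul t).exp.aestronglyMeasurable
      (Real.exp (|t| * (n * L))) (Eventually.of_forall fun ω => ?_)
    rw [Real.norm_eq_abs, Real.abs_exp, Real.exp_le_exp]
    refine (le_abs_self _).trans ?_
    rw [abs_mul]
    exact mul_le_mul_of_nonneg_left (abs_residueSum_le hL r n ω) (abs_nonneg t)
  have hsub : {ω | u ≤ |smallSum X L n ω|} ⊆
      ⋃ r ∈ Finset.range (m + 1), ({ω | v ≤ residueSum X (m + 1) L r n ω} ∪
        {ω | residueSum X (m + 1) L r n ω ≤ -v}) := by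
    intro ω hω
    by_contra hc
    simp only [Set.mem_iUnion, Set.mem_union, Set.mem_ofPred_eq, not_exists, not_or, not_le] at hc
    have h1 : smallSum X L n ω = ∑ r ∈ Finset.range (m + 1), residueSum X (m + 1) L r n ω :=
      (Finset.sum_fiberwise_of_maps_to (fun i _ => Finset.mem_range.2
        (Nat.mod_lt i (Nat.succ_pos m))) _).symm
    have h2 : |smallSum X L n ω| < u := by
      rw [h1]
      refine (Finset.abs_sum_le_sum_abs _ _).trans_lt ?_
      calc ∑ r ∈ Finset.range (m + 1), |residueSum X (m + 1) L r n ω|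
          < ∑ r ∈ Finset.range (m + 1), v :=
            Finset.sum_lt_sum_of_nonempty (by simp) fun r hr =>
              abs_lt.2 ⟨(hc r hr).2, (hc r hr).1⟩
        _ = u := by
            rw [Finset.sum_const, Finset.card_range, nsmul_eq_mul, hv]
            push_cast
            field_simp
    exact absurd hω (not_le.2 h2)
  refine (measureReal_mono hsub (measure_ne_top _ _)).trans
    ((measureReal_biUnion_finset_le _ _).trans ?_)
  refine (Finset.sum_le_card_nsmul _ _ (2 * (Real.exp (-h * v) * M ^ n)) fun r _ => ?_).trans
    (by rw [Finset.card_range, nsmul_eq_mul]; push_cast; rfl)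
  refine (measureReal_union_le _ _).trans ?_
  rw [two_mul]
  refine add_le_add ?_ ?_
  · refine (measure_ge_le_exp_mul_mgf v hh (hint h r)).trans ?_
    exact mul_le_mul_of_nonneg_left (mgf_residueSum_le hX hdep hid L h M hM1 hM r n)
      (Real.exp_pos _).le
  · refine (measure_le_le_exp_mul_mgf (-v) (neg_nonpos.2 hh) (hint (-h) r)).trans ?_
    rw [show - -h * -v = -h * v by ring]
    exact mul_le_mul_of_nonneg_left (mgf_residueSum_le hX hdep hid L (-h) M hM1 hM' r n)
      (Real.exp_pos _).le

theorem tendsto_log_pow_mul_rpow_neg (k : ℕ) {s : ℝ} (hs : 0 < s) :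
    Tendsto (fun x : ℝ => Real.log x ^ (k + 1) * x ^ (-s)) atTop (𝓝 0) := by
  have hk : (0 : ℝ) < k + 1 := by positivity
  have h := ((isLittleO_log_rpow_atTop (div_pos hs hk)).tendsto_div_nhds_zero).pow (k + 1)
  rw [zero_pow (Nat.succ_ne_zero k)] at h
  refine h.congr' ?_
  filter_upwards [eventually_gt_atTop 0] with x hx
  rw [div_pow, ← Real.rpow_natCast (x ^ (s / (k + 1))), ← Real.rpow_mul hx.le, Real.rpow_neg hx.le,
    div_eq_mul_inv]
  congr 3
  push_cast
  field_simp

/-- Truncated at a small multiple of `x`, the partial sum exceeds a given multiple of `x` with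
probability smaller than any prescribed power of `x`, as long as `n ≤ x ^ γ` with `γ` smaller than
an available moment. -/
theorem exists_smallSum_tail (hX : ∀ t, Measurable (X t)) {m : ℕ}
    (hdep : IsMDependent P X m) (hid : ∀ t, IdentDistrib (X t) (X 0) P P)
    {β γ : ℝ} (hβ : 0 < β) (hβ2 : β ≤ 2) (hγ : γ < β)
    (hi : Integrable (fun ω => |X 0 ω| ^ β) P)
    (hmean : Integrable (X 0) P → ∫ ω, X 0 ω ∂P = 0) {η ρ : ℝ} (hη : 0 < η) (hρ : 0 < ρ) :
    ∃ ε₀ : ℝ, 0 < ε₀ ∧ ∀ ε, 0 < ε → ε ≤ ε₀ → ∃ C x₁ : ℝ, ∀ x, x₁ ≤ x → ∀ n : ℕ,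
      (n : ℝ) ≤ x ^ γ → P.real {ω | η * x ≤ |smallSum X (ε * x) n ω|} ≤ C * x ^ (-ρ) := by
  have hD : (0 : ℝ) < m + 1 := by positivity
  -- with `h = c log x / x` the exponential factor of the Chernoff bound is `x ^ (-ρ)`
  set c : ℝ := ρ * (m + 1) / η with hc
  have hcpos : 0 < c := by positivity
  set s : ℝ := (β - γ) / 2 with hs
  have hspos : 0 < s := by rw [hs]; linarith
  refine ⟨s / c, by positivity, fun ε hε hε0 => ?_⟩
  set K : ℝ := ∫ ω, |X 0 ω| ^ β ∂P with hK
  have hK0 : 0 ≤ K := integral_nonneg fun ω => by positivity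
  have hεc : c * ε ≤ s := by
    have := (le_div_iff₀ hcpos).1 hε0
    linarith
  have l1 : Tendsto (fun x : ℝ => c * ε ^ (1 - β) * K * (Real.log x ^ 1 * x ^ (-(2 * s)))) atTop
      (𝓝 0) := by
    simpa using (tendsto_log_pow_mul_rpow_neg 0 (s := 2 * s) (by linarith)).const_mul
      (c * ε ^ (1 - β) * K)
  have l2 : Tendsto (fun x : ℝ => c ^ 2 * ε ^ (2 - β) * K * (Real.log x ^ 2 * x ^ (-s))) atTop
      (𝓝 0) := by
    simpa using (tendsto_log_pow_mul_rpow_neg 1 (s := s) hspos).const_mul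
      (c ^ 2 * ε ^ (2 - β) * K)
  obtain ⟨x₁, hx₁⟩ := eventually_atTop.1 ((l1.eventually (gt_mem_nhds one_pos)).and
    ((l2.eventually (gt_mem_nhds one_pos)).and (eventually_ge_atTop 1)))
  refine ⟨(m + 1) * (2 * Real.exp 2), x₁, fun x hx n hn => ?_⟩
  obtain ⟨h1, h2, hx1⟩ := hx₁ x hx
  have hx0 : 0 < x := by linarith
  have hlog : 0 ≤ Real.log x := Real.log_nonneg hx1
  set h : ℝ := c * Real.log x / x with hh
  have hh0 : 0 ≤ h := by positivity
  have hL : 0 < ε * x := by positivity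
  set Y : Ω → ℝ := fun ω => trunc (ε * x) (X 0 ω) with hY
  have hYm : Measurable Y := (measurable_trunc _).comp (hX 0)
  set A : ℝ := h * |∫ ω, Y ω ∂P| + h ^ 2 * (∫ ω, Y ω ^ 2 ∂P) * Real.exp (h * (ε * x)) with hA
  have hmgf := mgf_le_exp_of_bounded hYm (P := P) (fun ω => abs_trunc_le hL.le (X 0 ω)) h
  have hmgf' := mgf_le_exp_of_bounded hYm (P := P) (fun ω => abs_trunc_le hL.le (X 0 ω)) (-h)
  rw [abs_neg, neg_sq] at hmgf'
  rw [abs_of_nonneg hh0, ← hA] at hmgf hmgf'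
  have hY2 : 0 ≤ ∫ ω, Y ω ^ 2 ∂P := integral_nonneg fun ω => sq_nonneg _
  have hA0 : 0 ≤ A := by positivity
  have hnA : n * A ≤ 2 := by
    have e1 := abs_integral_trunc_le (hX 0) hL hβ hi hmean
    have e2 := integral_trunc_sq_le (P := P) hL hβ hβ2 hi
    have hexp : Real.exp (h * (ε * x)) ≤ x ^ s := by
      rw [Real.rpow_def_of_pos hx0, Real.exp_le_exp, hh]
      have : c * Real.log x / x * (ε * x) = (c * ε) * Real.log x := by field_simp
      rw [this, mul_comm]
      exact mul_le_mul_of_nonneg_left hεc hlog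
    have hxx : (1 : ℝ) = x⁻¹ * x := by field_simp
    have t1 : n * (h * |∫ ω, Y ω ∂P|) ≤ 1 := by
      refine le_trans ?_ h1.le
      calc n * (h * |∫ ω, Y ω ∂P|)
          ≤ x ^ γ * (h * ((ε * x) ^ (1 - β) * K)) := by gcongr
        _ = c * ε ^ (1 - β) * K * (Real.log x ^ 1 * (x ^ γ * x ^ (-1 : ℝ) * x ^ (1 - β))) := by
            rw [Real.mul_rpow hε.le hx0.le, hh, Real.rpow_neg_one]
            ring
        _ = _ := by
            rw [← Real.rpow_add hx0, ← Real.rpow_add hx0]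
            congr 3
            rw [hs]; ring
    have t2 : n * (h ^ 2 * (∫ ω, Y ω ^ 2 ∂P) * Real.exp (h * (ε * x))) ≤ 1 := by
      refine le_trans ?_ h2.le
      calc n * (h ^ 2 * (∫ ω, Y ω ^ 2 ∂P) * Real.exp (h * (ε * x)))
          ≤ x ^ γ * (h ^ 2 * ((ε * x) ^ (2 - β) * K) * x ^ s) := by gcongr
        _ = c ^ 2 * ε ^ (2 - β) * K *
            (Real.log x ^ 2 * (x ^ γ * x ^ (-2 : ℝ) * x ^ (2 - β) * x ^ s)) := by
            rw [Real.mul_rpow hε.le hx0.le, hh, Real.rpow_neg hx0.le, Real.rpow_two]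
            ring
        _ = _ := by
            rw [← Real.rpow_add hx0, ← Real.rpow_add hx0, ← Real.rpow_add hx0]
            congr 3
            rw [hs]; ring
    rw [hA, mul_add]
    linarith
  have := measureReal_abs_smallSum_ge_le hX hdep hid hL.le hh0 (Real.one_le_exp hA0)
    hmgf hmgf' n (η * x)
  refine this.trans ?_
  have e3 : Real.exp (-h * (η * x / (m + 1))) = x ^ (-ρ) := by
    rw [Real.rpow_def_of_pos hx0, hh, hc]
    congr 1
    field_simp
  have e4 : Real.exp A ^ n ≤ Real.exp 2 := by
    rw [← Real.exp_nat_mul, Real.exp_le_exp]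
    exact hnA
  rw [e3]
  calc ((m : ℝ) + 1) * (2 * (x ^ (-ρ) * Real.exp A ^ n))
      ≤ (m + 1) * (2 * (x ^ (-ρ) * Real.exp 2)) := by gcongr
    _ = _ := by ring

end

/-! ### Stationarity and the tail constants -/

section
variable {Ω : Type*} [MeasurableSpace Ω] {P : Measure Ω} {X : ℤ → Ω → ℝ}

theorem IsStrictlyStationary.measureReal_shift (hX : ∀ t, Measurable (X t))
    (hstat : IsStrictlyStationary P X) (h : ℤ) {B : Set (ℤ → ℝ)} (hB : MeasurableSet B) :
    P.real {ω | (fun t => X (t + h) ω) ∈ B} = P.real {ω | (fun t => X t ω) ∈ B} := by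
  have h1 : Measurable fun ω (t : ℤ) => X (t + h) ω := measurable_pi_lambda _ fun t => hX _
  have h2 : Measurable fun ω (t : ℤ) => X t ω := measurable_pi_lambda _ fun t => hX _
  have := congrArg (fun ν => ν.real B) (hstat h)
  simp only [measureReal_def, Measure.map_apply h1 hB, Measure.map_apply h2 hB] at this
  exact this

theorem IsStrictlyStationary.identDistrib (hX : ∀ t, Measurable (X t))
    (hstat : IsStrictlyStationary P X) (t : ℤ) : IdentDistrib (X t) (X 0) P P where
  aemeasurable_fst := (hX t).aemeasurable
  aemeasurable_snd := (hX 0).aemeasurable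
  map_eq := by
    have h1 : Measurable fun ω (s : ℤ) => X (s + t) ω := measurable_pi_lambda _ fun t => hX _
    have h2 : Measurable fun ω (s : ℤ) => X s ω := measurable_pi_lambda _ fun t => hX _
    have := congrArg (Measure.map fun y : ℤ → ℝ => y 0) (hstat t)
    rw [Measure.map_map (measurable_pi_apply 0) h1, Measure.map_map (measurable_pi_apply 0) h2]
      at this
    simpa [Function.comp_def] using this

omit [MeasurableSpace Ω] in
theorem partialSum_eq_sum_range (n : ℕ) (ω : Ω) :
    partialSum X n ω = ∑ j ∈ Finset.range n, X (1 + j) ω := by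
  unfold partialSum
  induction n with
  | zero => simp
  | succ n ih =>
    rw [Finset.sum_Icc_succ_top (by omega), ih, Finset.sum_range_succ]
    push_cast
    rw [add_comm (n : ℤ) 1]

/-- The tail function `x ↦ P (|X| > x)`. -/
noncomputable def tail (P : Measure Ω) (X : ℤ → Ω → ℝ) (x : ℝ) : ℝ := P.real {ω | x < |X 0 ω|}

theorem tail_nonneg (x : ℝ) : 0 ≤ tail P X x := measureReal_nonneg

theorem measureReal_tail_eq (hX : ∀ t, Measurable (X t)) (hstat : IsStrictlyStationary P X)
    (t : ℤ) (x : ℝ) : P.real {ω | x < |X t ω|} = tail P X x := by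
  have := (hstat.identDistrib hX t).measure_mem_eq
    (measurableSet_lt measurable_const measurable_id.abs : MeasurableSet {y : ℝ | x < |y|})
  simp only [tail, measureReal_def]
  exact congrArg ENNReal.toReal this

variable [IsProbabilityMeasure P]

theorem antitone_measureReal_lt (g : Ω → ℝ) : Antitone fun x => P.real {ω | x < g ω} :=
  fun _ _ hxy => measureReal_mono (fun _ hω => lt_of_le_of_lt hxy hω) (measure_ne_top _ _)

theorem tail_le_one (x : ℝ) : tail P X x ≤ 1 := measureReal_le_one

theorem IsRegularlyVarying.tail_properties (hX : ∀ t, Measurable (X t))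
    (hstat : IsStrictlyStationary P X) {α : ℝ} (hα : 0 < α) (hRV : IsRegularlyVarying P X α) :
    (∀ x, 0 < tail P X x) ∧
    (∀ c : ℝ, 0 < c → Tendsto (fun x => tail P X (c * x) / tail P X x) atTop (𝓝 (c ^ (-α)))) ∧
    ∀ k : ℕ, 1 ≤ k → ∃ b : ℝ, IsTailConstant P X k b := by
  obtain ⟨a, ha, hnorm, hd⟩ := hRV
  have hTanti : Antitone (tail P X) := antitone_measureReal_lt _
  have htail : ∀ c : ℝ, 0 < c →
      Tendsto (fun n : ℕ => (n : ℝ) * tail P X (c * a n)) atTop (𝓝 (c ^ (-α))) := by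
    obtain ⟨μ, hμ, hv, hh⟩ := hd 1 le_rfl
    obtain ⟨τ, hτ⟩ := hv.tendsto_homog (g := fun y => |y 0|) (by fun_prop)
      (fun t ht x => by simp [abs_mul, abs_of_pos ht]) hX ha hα hμ hh
    have hτ' : ∀ c : ℝ, 0 < c →
        Tendsto (fun n : ℕ => (n : ℝ) * tail P X (c * a n)) atTop (𝓝 (c ^ (-α) * τ)) := by
      intro c hc
      refine (hτ c hc).congr fun n => ?_
      rw [← measureReal_tail_eq hX hstat 1]
      simp
    have h1 := hτ' 1 one_pos
    simp only [one_mul, Real.one_rpow] at h1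
    have : τ = 1 := tendsto_nhds_unique h1 hnorm
    intro c hc
    simpa [this] using hτ' c hc
  refine ⟨pos_of_tendsto_normalized hTanti tail_nonneg ha htail, fun c hc => ?_, fun k hk => ?_⟩
  · refine tendsto_div_of_tendsto_normalized (F := fun x => tail P X (c * x)) hTanti tail_nonneg
      (fun x y hxy => hTanti (mul_le_mul_of_nonneg_left hxy hc.le)) hα ha htail fun c' hc' => ?_
    rw [mul_comm (c' ^ (-α)), ← Real.mul_rpow hc.le hc'.le]
    simpa only [mul_assoc] using htail (c * c') (mul_pos hc hc')
  · obtain ⟨μ, hμ, hv, hh⟩ := hd k hk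
    obtain ⟨τ, hτ⟩ := hv.tendsto_homog (g := fun y => ∑ i, y i) (by fun_prop)
      (fun t ht x => by simp [Finset.mul_sum]) hX ha hα hμ hh
    refine ⟨τ, tendsto_div_of_tendsto_normalized hTanti tail_nonneg
      (antitone_measureReal_lt (P := P) (partialSum X k)) hα ha htail fun c hc => ?_⟩
    refine (hτ c hc).congr fun n => ?_
    congr 2
    ext ω
    rw [Set.mem_ofPred_eq, Set.mem_ofPred_eq, partialSum_eq_sum_range, Finset.sum_range]
    simp only [add_comm]

/-! ### Sums of exceedances -/

/-- The sum over `k` consecutive indices, starting at `s`, of the parts of the variables that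
exceed the level `L` in absolute value. -/
noncomputable def bigSum (X : ℤ → Ω → ℝ) (L : ℝ) (s : ℤ) (k : ℕ) (ω : Ω) : ℝ :=
  ∑ j ∈ Finset.range k, (X (s + j) ω - trunc L (X (s + j) ω))

theorem sub_trunc_eq_zero {L y : ℝ} (h : |y| ≤ L) : y - trunc L y = 0 := by simp [trunc, h]

theorem measurable_sub_trunc (L : ℝ) : Measurable fun y => y - trunc L y :=
  measurable_id.sub (measurable_trunc L)

theorem measurable_bigSum (hX : ∀ t, Measurable (X t)) (L : ℝ) (s : ℤ) (k : ℕ) :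
    Measurable (bigSum X L s k) :=
  Finset.measurable_fun_sum _ fun _ _ => (measurable_sub_trunc L).comp (hX _)

omit [MeasurableSpace Ω] in
theorem smallSum_add_bigSum (L : ℝ) (n : ℕ) (ω : Ω) :
    smallSum X L n ω + bigSum X L 1 n ω = partialSum X n ω := by
  have : smallSum X L n ω = partialSum (fun t ω => trunc L (X t ω)) n ω := rfl
  rw [this, partialSum_eq_sum_range, partialSum_eq_sum_range, bigSum, ← Finset.sum_add_distrib]
  exact Finset.sum_congr rfl fun j _ => by ring

omit [MeasurableSpace Ω] in
theorem abs_smallSum_le {L : ℝ} (hL : 0 ≤ L) (n : ℕ) (ω : Ω) : |smallSum X L n ω| ≤ n * L := by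
  refine (Finset.abs_sum_le_sum_abs _ _).trans ?_
  refine (Finset.sum_le_card_nsmul _ _ L fun i _ => abs_trunc_le hL _).trans ?_
  simp

omit [MeasurableSpace Ω] in
theorem bigSum_succ_left (L : ℝ) (s : ℤ) (k : ℕ) (ω : Ω) :
    bigSum X L s (k + 1) ω = (X s ω - trunc L (X s ω)) + bigSum X L (s + 1) k ω := by
  unfold bigSum
  rw [Finset.sum_range_succ', add_comm]
  simp only [Nat.cast_zero, add_zero, Nat.cast_succ, add_assoc, add_comm (1 : ℤ)]

omit [MeasurableSpace Ω] in
theorem bigSum_eq_of_le {L : ℝ} {s : ℤ} {l k : ℕ} (hlk : l ≤ k) {ω : Ω}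
    (h : ∀ j, l ≤ j → j < k → |X (s + j) ω| ≤ L) : bigSum X L s k ω = bigSum X L s l ω := by
  unfold bigSum
  refine (Finset.sum_subset (Finset.range_mono hlk) fun j hj hj' => ?_).symm
  exact sub_trunc_eq_zero (h j (by simpa using hj') (by simpa using hj))

omit [IsProbabilityMeasure P] in
theorem measureReal_lt_bigSum (hX : ∀ t, Measurable (X t)) (hstat : IsStrictlyStationary P X)
    (L z : ℝ) (s : ℤ) (k : ℕ) :
    P.real {ω | z < bigSum X L s k ω} = P.real {ω | z < bigSum X L 1 k ω} := by
  let B : Set (ℤ → ℝ) := {y | z < ∑ j ∈ Finset.range k, (y (1 + j) - trunc L (y (1 + j)))}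
  have hB : MeasurableSet B := measurableSet_lt measurable_const
    (Finset.measurable_fun_sum _ fun _ _ => (measurable_sub_trunc L).comp (measurable_pi_apply _))
  have := hstat.measureReal_shift hX (s - 1) hB
  rw [show {ω | z < bigSum X L 1 k ω} = {ω | (fun t => X t ω) ∈ B} from rfl, ← this]
  congr 1
  ext ω
  simp only [bigSum, B, Set.mem_ofPred_eq]
  refine iff_of_eq (congrArg (z < ·) (Finset.sum_congr rfl fun j _ => ?_))
  rw [show (1 : ℤ) + j + (s - 1) = s + j by ring]

/-- If off `B` the four sets agree in pairs so that the alternating sum of their indicators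
vanishes, then the alternating sum of their probabilities is at most `2 P(B)`. -/
theorem abs_sub_sub_sub_le_of_off_bad {A₁ A₂ A₃ A₄ B : Set Ω} (h1 : MeasurableSet A₁)
    (h2 : MeasurableSet A₂) (h3 : MeasurableSet A₃) (h4 : MeasurableSet A₄) (hB : MeasurableSet B)
    (h : ∀ ω ∉ B, ((ω ∈ A₁ ↔ ω ∈ A₂) ∧ (ω ∈ A₃ ↔ ω ∈ A₄)) ∨
      ((ω ∈ A₁ ↔ ω ∈ A₃) ∧ (ω ∈ A₂ ↔ ω ∈ A₄))) :
    |P.real A₁ - P.real A₂ - (P.real A₃ - P.real A₄)| ≤ 2 * P.real B := by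
  have hi : ∀ {A : Set Ω}, MeasurableSet A → Integrable (A.indicator (1 : Ω → ℝ)) P :=
    fun hA => (integrable_const (1 : ℝ)).indicator hA
  have e : P.real A₁ - P.real A₂ - (P.real A₃ - P.real A₄) =
      ∫ ω, (A₁.indicator (1 : Ω → ℝ) ω - A₂.indicator (1 : Ω → ℝ) ω -
        (A₃.indicator (1 : Ω → ℝ) ω - A₄.indicator (1 : Ω → ℝ) ω)) ∂P := by
    rw [integral_sub (f := fun ω => A₁.indicator (1 : Ω → ℝ) ω - A₂.indicator (1 : Ω → ℝ) ω)
      (g := fun ω => A₃.indicator (1 : Ω → ℝ) ω - A₄.indicator (1 : Ω → ℝ) ω)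
      ((hi h1).sub (hi h2)) ((hi h3).sub (hi h4)), integral_sub (hi h1) (hi h2),
      integral_sub (hi h3) (hi h4), integral_indicator_one h1, integral_indicator_one h2,
      integral_indicator_one h3, integral_indicator_one h4]
  rw [e, ← integral_indicator_one hB, ← integral_const_mul]
  refine abs_integral_le_integral_abs.trans ?_
  refine integral_mono (((hi h1).sub (hi h2)).sub ((hi h3).sub (hi h4))).abs
    ((hi hB).const_mul 2) fun ω => ?_
  have h01 : ∀ A : Set Ω, 0 ≤ A.indicator (1 : Ω → ℝ) ω ∧ A.indicator (1 : Ω → ℝ) ω ≤ 1 :=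
    fun A => ⟨Set.indicator_nonneg (fun _ _ => zero_le_one) ω,
      Set.indicator_le_self' (fun _ _ => zero_le_one) ω⟩
  by_cases hω : ω ∈ B
  · simp only [Set.indicator_of_mem hω, Pi.one_apply]
    have := h01 A₁; have := h01 A₂; have := h01 A₃; have := h01 A₄
    rw [abs_le]
    constructor <;> linarith
  · simp only [Set.indicator_of_notMem hω]
    have hc : ∀ {A A' : Set Ω}, (ω ∈ A ↔ ω ∈ A') →
        A.indicator (1 : Ω → ℝ) ω = A'.indicator (1 : Ω → ℝ) ω := by
      intro A A' hAA'
      by_cases hA : ω ∈ A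
      · rw [Set.indicator_of_mem hA, Set.indicator_of_mem (hAA'.1 hA)]
      · rw [Set.indicator_of_notMem hA, Set.indicator_of_notMem (mt hAA'.2 hA)]
    rcases h ω hω with ⟨h12, h34⟩ | ⟨h13, h24⟩
    · rw [hc h12, hc h34]; simp
    · rw [hc h13, hc h24]; simp

/-- Up to the event that two exceedances occur at distance more than `m`, adding one more variable
at the start changes the law of the sum of exceedances as it does for a window of length `m`. -/
theorem abs_increment_bigSum_le (hX : ∀ t, Measurable (X t)) (hstat : IsStrictlyStationary P X)
    {m : ℕ} (hdep : IsMDependent P X m) (L z : ℝ) {k : ℕ} (hk : m ≤ k) :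
    |P.real {ω | z < bigSum X L 1 (k + 1) ω} - P.real {ω | z < bigSum X L 1 k ω} -
      (P.real {ω | z < bigSum X L 1 (m + 1) ω} - P.real {ω | z < bigSum X L 1 m ω})| ≤
      2 * (k * tail P X L ^ 2) := by
  have hE : ∀ t, MeasurableSet {ω | L < |X t ω|} := fun t =>
    measurableSet_lt measurable_const (hX t).abs
  have hA : ∀ s k, MeasurableSet {ω | z < bigSum X L s k ω} := fun s k =>
    measurableSet_lt measurable_const (measurable_bigSum hX L s k)
  set B : Set Ω := ⋃ j ∈ Finset.Ico (m + 1) (k + 1), ({ω | L < |X 1 ω|} ∩ {ω | L < |X (1 + j) ω|})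
    with hBdef
  have hB : MeasurableSet B := Finset.measurableSet_biUnion _ fun j _ => (hE _).inter (hE _)
  have hPB : P.real B ≤ k * tail P X L ^ 2 := by
    refine (measureReal_biUnion_finset_le _ _).trans ?_
    refine (Finset.sum_le_card_nsmul _ _ (tail P X L ^ 2) fun j hj => ?_).trans ?_
    · have hj' : (1 + (j : ℤ)) ∈ Set.Ioi ((1 : ℤ) + m) := by
        simp only [Finset.mem_Ico] at hj
        simp only [Set.mem_Ioi]; omega
      have hind : IndepFun (X 1) (X (1 + (j : ℤ))) P :=
        (hdep 1).comp (measurable_pi_apply (⟨1, Set.mem_Iic.2 le_rfl⟩ : Set.Iic (1 : ℤ)))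
          (measurable_pi_apply (⟨_, hj'⟩ : Set.Ioi ((1 : ℤ) + m)))
      have hs : MeasurableSet {y : ℝ | L < |y|} :=
        measurableSet_lt measurable_const measurable_id.abs
      have := hind.measure_inter_preimage_eq_mul _ _ hs hs
      have e := congrArg ENNReal.toReal this
      rw [ENNReal.toReal_mul] at e
      change P.real ({ω | L < |X 1 ω|} ∩ {ω | L < |X (1 + j) ω|}) =
        P.real {ω | L < |X 1 ω|} * P.real {ω | L < |X (1 + j) ω|} at e
      rw [e, measureReal_tail_eq hX hstat, measureReal_tail_eq hX hstat, sq]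
    · rw [Nat.card_Ico, nsmul_eq_mul]
      refine mul_le_mul_of_nonneg_right ?_ (sq_nonneg _)
      exact_mod_cast (by omega)
  rw [← measureReal_lt_bigSum hX hstat L z 2 k, ← measureReal_lt_bigSum hX hstat L z 2 m]
  refine (abs_sub_sub_sub_le_of_off_bad (hA _ _) (hA _ _) (hA _ _) (hA _ _) hB
    fun ω hω => ?_).trans (by linarith)
  simp only [Set.mem_ofPred_eq]
  by_cases h1 : |X 1 ω| ≤ L
  · left
    rw [bigSum_succ_left, bigSum_succ_left, sub_trunc_eq_zero h1, zero_add, zero_add]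
    exact ⟨Iff.rfl, Iff.rfl⟩
  · right
    have h2 : ∀ j : ℕ, m + 1 ≤ j → j < k + 1 → |X (1 + j) ω| ≤ L := by
      intro j hj hjk
      by_contra hc
      refine hω ?_
      simp only [hBdef, Set.mem_iUnion, Finset.mem_Ico]
      exact ⟨j, ⟨hj, hjk⟩, not_le.1 h1, not_le.1 hc⟩
    rw [bigSum_eq_of_le (Nat.succ_le_succ hk) h2, bigSum_eq_of_le (s := 2) hk fun j hj hjk => ?_]
    · exact ⟨Iff.rfl, Iff.rfl⟩
    · have := h2 (j + 1) (by omega) (by omega)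
      push_cast at this
      rwa [show (1 : ℤ) + (j + 1) = 2 + j by ring] at this

/-- The increments of `k ↦ P(∑_{i ≤ k} X_i 𝟙(|X_i| > L) > z)` are all close to the one at `m`; summing
them makes this function nearly affine in `k ≥ m`. -/
theorem abs_bigSum_sub_le (hX : ∀ t, Measurable (X t)) (hstat : IsStrictlyStationary P X)
    {m : ℕ} (hdep : IsMDependent P X m) (L z : ℝ) {n : ℕ} (hn : m ≤ n) :
    |P.real {ω | z < bigSum X L 1 n ω} - (P.real {ω | z < bigSum X L 1 m ω} + (n - m) *
      (P.real {ω | z < bigSum X L 1 (m + 1) ω} - P.real {ω | z < bigSum X L 1 m ω}))| ≤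
      2 * n ^ 2 * tail P X L ^ 2 := by
  induction n, hn using Nat.le_induction with
  | base =>
    rw [sub_self, zero_mul, add_zero, sub_self, abs_zero]
    positivity
  | succ k hk ih =>
    have h1 := abs_increment_bigSum_le hX hstat hdep L z hk
    rw [abs_le] at h1 ih ⊢
    have h2 : (0 : ℝ) ≤ k * tail P X L ^ 2 := by positivity
    have h3 : (0 : ℝ) ≤ tail P X L ^ 2 := by positivity
    push_cast
    constructor <;> nlinarith

/-! ### Sandwich bounds for the tail of the partial sums -/

theorem measureReal_lt_partialSum_le (X : ℤ → Ω → ℝ) (L z u : ℝ) (k : ℕ) :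
    P.real {ω | z < partialSum X k ω} ≤
      P.real {ω | z - u < bigSum X L 1 k ω} + P.real {ω | u ≤ |smallSum X L k ω|} := by
  refine (measureReal_mono (fun ω hω => ?_) (measure_ne_top _ _)).trans (measureReal_union_le _ _)
  rw [Set.mem_ofPred_eq, ← smallSum_add_bigSum L] at hω
  by_cases h : u ≤ |smallSum X L k ω|
  · exact Or.inr h
  · left
    rw [Set.mem_ofPred_eq]
    linarith [le_abs_self (smallSum X L k ω)]

theorem measureReal_lt_bigSum_le (X : ℤ → Ω → ℝ) (L z u : ℝ) (k : ℕ) :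
    P.real {ω | z < bigSum X L 1 k ω} ≤
      P.real {ω | z - u < partialSum X k ω} + P.real {ω | u ≤ |smallSum X L k ω|} := by
  refine (measureReal_mono (fun ω hω => ?_) (measure_ne_top _ _)).trans (measureReal_union_le _ _)
  rw [Set.mem_ofPred_eq] at hω
  by_cases h : u ≤ |smallSum X L k ω|
  · exact Or.inr h
  · left
    rw [Set.mem_ofPred_eq, ← smallSum_add_bigSum L]
    linarith [neg_abs_le (smallSum X L k ω)]

omit [IsProbabilityMeasure P] in
theorem measureReal_smallSum_eq_zero {L u : ℝ} (hL : 0 ≤ L) {k : ℕ} (h : k * L < u) :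
    P.real {ω | u ≤ |smallSum X L k ω|} = 0 := by
  have : {ω | u ≤ |smallSum X L k ω|} = ∅ := by
    ext ω
    simp only [Set.mem_ofPred_eq, Set.mem_empty_iff_false, iff_false, not_le]
    exact (abs_smallSum_le hL k ω).trans_lt h
  rw [this, measureReal_empty]

/-- Bounds for `P(S_n > x)` by the tails of `S_m` and `S_{m+1}` at nearby levels. For `m` and `m + 1`
summands the truncated part is deterministically below `u`. -/
theorem measureReal_partialSum_bounds (hX : ∀ t, Measurable (X t))
    (hstat : IsStrictlyStationary P X) {m : ℕ} (hdep : IsMDependent P X m) {L u : ℝ}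
    (hL : 0 ≤ L) (hLu : (m + 1) * L < u) (x : ℝ) {n : ℕ} (hn : m ≤ n) :
    P.real {ω | x < partialSum X n ω} ≤ P.real {ω | x - 2 * u < partialSum X m ω} + (n - m) *
        (P.real {ω | x - 2 * u < partialSum X (m + 1) ω} - P.real {ω | x < partialSum X m ω}) +
        2 * n ^ 2 * tail P X L ^ 2 + P.real {ω | u ≤ |smallSum X L n ω|} ∧
    P.real {ω | x + 2 * u < partialSum X m ω} + (n - m) *
        (P.real {ω | x + 2 * u < partialSum X (m + 1) ω} - P.real {ω | x < partialSum X m ω}) -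
        2 * n ^ 2 * tail P X L ^ 2 - P.real {ω | u ≤ |smallSum X L n ω|} ≤
      P.real {ω | x < partialSum X n ω} := by
  have hnm : (0 : ℝ) ≤ n - m := sub_nonneg.2 (by exact_mod_cast hn)
  have z1 : P.real {ω | u ≤ |smallSum X L m ω|} = 0 :=
    measureReal_smallSum_eq_zero hL (by nlinarith)
  have z2 : P.real {ω | u ≤ |smallSum X L (m + 1) ω|} = 0 :=
    measureReal_smallSum_eq_zero hL (by push_cast; exact hLu)
  constructor
  · have h1 := measureReal_lt_partialSum_le (P := P) X L x u n
    have h2 := (abs_le.1 (abs_bigSum_sub_le hX hstat hdep L (x - u) hn)).2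
    have h3 := measureReal_lt_bigSum_le (P := P) X L (x - u) u m
    have h4 := measureReal_lt_bigSum_le (P := P) X L (x - u) u (m + 1)
    have h5 := measureReal_lt_partialSum_le (P := P) X L x u m
    rw [z1, add_zero] at h3 h5
    rw [z2, add_zero] at h4
    rw [show x - u - u = x - 2 * u by ring] at h3 h4
    have h6 := mul_le_mul_of_nonneg_left (sub_le_sub h4 h5) hnm
    linarith
  · have h1 := measureReal_lt_bigSum_le (P := P) X L (x + u) u n
    have h2 := (abs_le.1 (abs_bigSum_sub_le hX hstat hdep L (x + u) hn)).1
    have h3 := measureReal_lt_partialSum_le (P := P) X L (x + 2 * u) u m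
    have h4 := measureReal_lt_partialSum_le (P := P) X L (x + 2 * u) u (m + 1)
    have h5 := measureReal_lt_bigSum_le (P := P) X L (x + u) u m
    rw [z1, add_zero] at h3 h5
    rw [z2, add_zero] at h4
    rw [show x + 2 * u - u = x + u by ring] at h3 h4
    rw [add_sub_cancel_right] at h1 h5
    have h6 := mul_le_mul_of_nonneg_left (sub_le_sub h4 h5) hnm
    linarith

end

/-! ### Limits along joint filters in `(n, x)` -/

section
variable {Ω : Type*} [MeasurableSpace Ω] {P : Measure Ω} [IsProbabilityMeasure P] {X : ℤ → Ω → ℝ}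

omit [IsProbabilityMeasure P] in
theorem IsTailConstant.tendsto_scaled {α b c : ℝ} {k : ℕ} (hpos : ∀ x, 0 < tail P X x)
    (hrv : ∀ c : ℝ, 0 < c →
      Tendsto (fun x => tail P X (c * x) / tail P X x) atTop (𝓝 (c ^ (-α))))
    (hb : IsTailConstant P X k b) (hc : 0 < c) :
    Tendsto (fun x => P.real {ω | c * x < partialSum X k ω} / tail P X x) atTop
      (𝓝 (b * c ^ (-α))) := by
  have h1 : Tendsto (fun x : ℝ => c * x) atTop atTop := tendsto_id.const_mul_atTop hc
  have h2 := (Tendsto.comp hb h1).mul (hrv c hc)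
  refine h2.congr fun x => ?_
  have e1 : tail P X (c * x) ≠ 0 := (hpos _).ne'
  have e2 : tail P X x ≠ 0 := (hpos _).ne'
  change P.real {ω | c * x < partialSum X k ω} / tail P X (c * x) * _ = _
  field_simp

/-- Asymptotics of `P (S_n > x) / (n P (|X| > x))` along a filter of pairs `(n, x)` along which
exceedances are rare and the truncated part of `S_n` is negligible. It covers both `x → ∞` for fixed
`n`, with `κ = 1 / n`, and large deviations, with `κ = 0`. -/
theorem tendsto_partialSum_div (hX : ∀ t, Measurable (X t))
    (hstat : IsStrictlyStationary P X) {m : ℕ} (hm : 1 ≤ m) (hdep : IsMDependent P X m)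
    {α : ℝ} (hpos : ∀ x, 0 < tail P X x)
    (hrv : ∀ c : ℝ, 0 < c →
      Tendsto (fun x => tail P X (c * x) / tail P X x) atTop (𝓝 (c ^ (-α))))
    {b₀ b₁ : ℝ} (hb₀ : IsTailConstant P X m b₀) (hb₁ : IsTailConstant P X (m + 1) b₁)
    {F : Filter (ℕ × ℝ)} (hF : Tendsto Prod.snd F atTop) {κ : ℝ}
    (hκ : Tendsto (fun p : ℕ × ℝ => (p.1 : ℝ)⁻¹) F (𝓝 κ)) (hmF : ∀ᶠ p in F, m ≤ p.1)
    (hrare : ∀ ε : ℝ, 0 < ε → Tendsto (fun p : ℕ × ℝ => p.1 * tail P X (ε * p.2)) F (𝓝 0))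
    (hsmall : ∀ η : ℝ, 0 < η → ∃ ε₀ : ℝ, 0 < ε₀ ∧ ∀ ε, 0 < ε → ε ≤ ε₀ →
      Tendsto (fun p : ℕ × ℝ => P.real {ω | η * p.2 ≤ |smallSum X (ε * p.2) p.1 ω|} /
        (p.1 * tail P X p.2)) F (𝓝 0)) :
    Tendsto (fun p : ℕ × ℝ => P.real {ω | p.2 < partialSum X p.1 ω} / (p.1 * tail P X p.2)) F
      (𝓝 (κ * b₀ + (1 - m * κ) * (b₁ - b₀))) := by
  set ℓ : ℝ → ℝ := fun θ => κ * (b₀ * (1 + θ) ^ (-α)) + (1 - m * κ) * (b₁ * (1 + θ) ^ (-α) - b₀)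
    with hℓ
  have hpow : ContinuousAt (fun θ : ℝ => (1 + θ) ^ (-α)) 0 :=
    (continuousAt_const.add continuousAt_id).rpow_const (Or.inl (by simp))
  have hℓc : Tendsto ℓ (𝓝 0) (𝓝 (κ * b₀ + (1 - m * κ) * (b₁ - b₀))) := by
    have : ContinuousAt ℓ 0 := by
      rw [hℓ]
      fun_prop
    simpa [ContinuousAt, hℓ] using this
  -- the common limit of the two bounds at relative distance `θ`
  have hmain : ∀ θ : ℝ, -1 < θ → Tendsto (fun p : ℕ × ℝ =>
      (p.1 : ℝ)⁻¹ * (P.real {ω | (1 + θ) * p.2 < partialSum X m ω} / tail P X p.2) +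
      (1 - m * (p.1 : ℝ)⁻¹) *
        (P.real {ω | (1 + θ) * p.2 < partialSum X (m + 1) ω} / tail P X p.2 -
          P.real {ω | p.2 < partialSum X m ω} / tail P X p.2)) F (𝓝 (ℓ θ)) := by
    intro θ hθ
    have hθ' : 0 < 1 + θ := by linarith
    have t0 := (hb₀.tendsto_scaled hpos hrv hθ').comp hF
    have t1 := (hb₁.tendsto_scaled hpos hrv hθ').comp hF
    have t2 := Tendsto.comp hb₀ hF
    exact (hκ.mul t0).add (((tendsto_const_nhds.sub (hκ.const_mul _))).mul (t1.sub t2))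
  have herr : ∀ η : ℝ, 0 < η → ∃ ε : ℝ, 0 < ε ∧ (m + 1) * ε < η ∧
      Tendsto (fun p : ℕ × ℝ => 2 * (p.1 * tail P X (ε * p.2)) *
        (tail P X (ε * p.2) / tail P X p.2) +
        P.real {ω | η * p.2 ≤ |smallSum X (ε * p.2) p.1 ω|} / (p.1 * tail P X p.2)) F (𝓝 0) := by
    intro η hη
    obtain ⟨ε₀, hε₀, h⟩ := hsmall η hη
    have hm1 : (0 : ℝ) < m + 1 + 1 := by positivity
    set ε := min ε₀ (η / (m + 1 + 1)) with hεdef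
    have hε : 0 < ε := lt_min hε₀ (by positivity)
    refine ⟨ε, hε, ?_, ?_⟩
    · have : ε * (m + 1 + 1) ≤ η := (le_div_iff₀ hm1).1 (min_le_right _ _)
      nlinarith
    · have t := (((hrare ε hε).const_mul 2).mul ((hrv ε hε).comp hF)).add
        (h ε hε (min_le_left _ _))
      simpa using t
  have hev : ∀ᶠ p in F, m ≤ p.1 ∧ 0 < p.2 := hmF.and (hF.eventually (eventually_gt_atTop 0))
  -- the sandwich bounds, divided by `n P (|X| > x)`
  have hdiv : ∀ (n : ℕ) (x A B C e r : ℝ), 1 ≤ n →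
      (A + (n - m) * (B - C) + e * (2 * n ^ 2 * tail P X r ^ 2)) / (n * tail P X x) =
      ((n : ℝ)⁻¹ * (A / tail P X x) + (1 - m * (n : ℝ)⁻¹) * (B / tail P X x - C / tail P X x)) +
        e * (2 * (n * tail P X r) * (tail P X r / tail P X x)) := by
    intro n x A B C e r hn
    have h1 : (n : ℝ) ≠ 0 := by positivity
    have h2 : tail P X x ≠ 0 := (hpos x).ne'
    field_simp
  have hden : ∀ p : ℕ × ℝ, m ≤ p.1 → 0 < (p.1 : ℝ) * tail P X p.2 := fun p hp =>
    mul_pos (by exact_mod_cast (by omega)) (hpos _)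
  rw [tendsto_order]
  constructor
  · intro a ha
    obtain ⟨ρ, hρ, hball⟩ := Metric.eventually_nhds_iff.1 (hℓc.eventually (lt_mem_nhds ha))
    set η := ρ / 4 with hη
    have hη0 : 0 < η := by positivity
    have hθ : a < ℓ (2 * η) := hball (by
      rw [Real.dist_eq, sub_zero, abs_of_pos (by positivity)]; linarith)
    obtain ⟨ε, hε, hεη, hlim⟩ := herr η hη0
    have hlim' := (hmain (2 * η) (by linarith)).sub hlim
    rw [sub_zero] at hlim'
    filter_upwards [hlim'.eventually (lt_mem_nhds hθ), hev] with p hp ⟨hpm, hp0⟩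
    have hb := (measureReal_partialSum_bounds hX hstat hdep (L := ε * p.2) (u := η * p.2)
      (by positivity) (by nlinarith) p.2 hpm).2
    refine hp.trans_le ?_
    refine le_trans (le_of_eq ?_) (div_le_div_of_nonneg_right hb (hden p hpm).le)
    have := hdiv p.1 p.2 (P.real {ω | (1 + 2 * η) * p.2 < partialSum X m ω})
      (P.real {ω | (1 + 2 * η) * p.2 < partialSum X (m + 1) ω})
      (P.real {ω | p.2 < partialSum X m ω}) (-1) (ε * p.2) (hm.trans hpm)
    rw [show p.2 + 2 * (η * p.2) = (1 + 2 * η) * p.2 by ring, sub_div, ← sub_sub, sub_left_inj,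
      sub_eq_add_neg, ← neg_one_mul, ← this]
    congr 1
    ring
  · intro a ha
    obtain ⟨ρ, hρ, hball⟩ := Metric.eventually_nhds_iff.1 (hℓc.eventually (gt_mem_nhds ha))
    set η := min (ρ / 4) (1 / 4) with hη
    have hη0 : 0 < η := by positivity
    have hηρ : η ≤ ρ / 4 := min_le_left _ _
    have hη4 : η ≤ 1 / 4 := min_le_right _ _
    have hθ : ℓ (-(2 * η)) < a := hball (by
      rw [Real.dist_eq, sub_zero, abs_neg, abs_of_pos (by positivity)]; linarith)
    obtain ⟨ε, hε, hεη, hlim⟩ := herr η hη0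
    have hlim' := (hmain (-(2 * η)) (by linarith)).add hlim
    rw [add_zero] at hlim'
    filter_upwards [hlim'.eventually (gt_mem_nhds hθ), hev] with p hp ⟨hpm, hp0⟩
    have hb := (measureReal_partialSum_bounds hX hstat hdep (L := ε * p.2) (u := η * p.2)
      (by positivity) (by nlinarith) p.2 hpm).1
    refine lt_of_le_of_lt ?_ hp
    refine le_trans (div_le_div_of_nonneg_right hb (hden p hpm).le) (le_of_eq ?_)
    have := hdiv p.1 p.2 (P.real {ω | (1 + -(2 * η)) * p.2 < partialSum X m ω})
      (P.real {ω | (1 + -(2 * η)) * p.2 < partialSum X (m + 1) ω})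
      (P.real {ω | p.2 < partialSum X m ω}) 1 (ε * p.2) (hm.trans hpm)
    rw [one_mul, one_mul] at this
    rw [show p.2 - 2 * (η * p.2) = (1 + -(2 * η)) * p.2 by ring, add_div, ← add_assoc, ← this]

/-- From `m` on, the tail constants of an `m`-dependent sequence grow linearly. -/
theorem tailConstant_eq (hX : ∀ t, Measurable (X t))
    (hstat : IsStrictlyStationary P X) {m : ℕ} (hm : 1 ≤ m) (hdep : IsMDependent P X m)
    {α : ℝ} (hpos : ∀ x, 0 < tail P X x) (hzero : Tendsto (tail P X) atTop (𝓝 0))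
    (hrv : ∀ c : ℝ, 0 < c →
      Tendsto (fun x => tail P X (c * x) / tail P X x) atTop (𝓝 (c ^ (-α))))
    {b₀ b₁ b : ℝ} (hb₀ : IsTailConstant P X m b₀) (hb₁ : IsTailConstant P X (m + 1) b₁)
    {n : ℕ} (hn : m ≤ n) (hb : IsTailConstant P X n b) :
    b = b₀ + (n - m) * (b₁ - b₀) := by
  have hn0 : (0 : ℝ) < n := by exact_mod_cast (by omega)
  have h := tendsto_partialSum_div hX hstat hm hdep hpos hrv hb₀ hb₁
    (F := map (fun x : ℝ => (n, x)) atTop) (κ := (n : ℝ)⁻¹) (tendsto_map'_iff.2 tendsto_id)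
    (tendsto_map'_iff.2 tendsto_const_nhds) (eventually_map.2 (Eventually.of_forall fun _ => hn))
    (fun ε hε => by
      rw [tendsto_map'_iff]
      simpa [Function.comp_def] using
        (hzero.comp (tendsto_id.const_mul_atTop hε)).const_mul (n : ℝ))
    (fun η hη => by
      refine ⟨η / (n + 1), by positivity, fun ε hε hεη => ?_⟩
      rw [tendsto_map'_iff]
      refine tendsto_const_nhds.congr' ?_
      filter_upwards [eventually_gt_atTop 0] with x hx
      have : ε * (n + 1) ≤ η := (le_div_iff₀ (by positivity)).1 hεη
      simp only [Function.comp]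
      rw [measureReal_smallSum_eq_zero (by positivity) (by nlinarith), zero_div])
  rw [tendsto_map'_iff] at h
  have h2 := tendsto_nhds_unique (h.const_mul (n : ℝ)) (hb.congr fun x => by
    have e1 : tail P X x ≠ 0 := (hpos _).ne'
    change P.real {ω | x < partialSum X n ω} / tail P X x =
      (n : ℝ) * (P.real {ω | x < partialSum X n ω} / (n * tail P X x))
    field_simp)
  rw [← h2]
  field_simp

/-- The filter of pairs `(n, x)` with `n → ∞` and `x > n ^ q`. -/
def largeDeviationFilter (q : ℝ) : Filter (ℕ × ℝ) :=
  comap Prod.fst atTop ⊓ 𝓟 {p | (p.1 : ℝ) ^ q < p.2}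

theorem tendsto_fst_largeDeviationFilter (q : ℝ) :
    Tendsto Prod.fst (largeDeviationFilter q) atTop :=
  tendsto_comap.mono_left inf_le_left

theorem eventually_rpow_lt_largeDeviationFilter (q : ℝ) :
    ∀ᶠ p in largeDeviationFilter q, (p.1 : ℝ) ^ q < p.2 :=
  mem_inf_of_right (mem_principal_self _)

theorem tendsto_snd_largeDeviationFilter {q : ℝ} (hq : 0 < q) :
    Tendsto Prod.snd (largeDeviationFilter q) atTop :=
  tendsto_atTop_mono' _ ((eventually_rpow_lt_largeDeviationFilter q).mono fun _ h => h.le)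
    ((tendsto_rpow_atTop hq).comp
      (tendsto_natCast_atTop_atTop.comp (tendsto_fst_largeDeviationFilter q)))

theorem eventually_le_rpow_largeDeviationFilter {q : ℝ} (hq : 0 < q) :
    ∀ᶠ p in largeDeviationFilter q, (p.1 : ℝ) ≤ p.2 ^ q⁻¹ := by
  filter_upwards [eventually_rpow_lt_largeDeviationFilter q] with p hp
  have h0 : (0 : ℝ) ≤ p.1 := Nat.cast_nonneg _
  calc (p.1 : ℝ) = ((p.1 : ℝ) ^ q) ^ q⁻¹ := (Real.rpow_rpow_inv h0 hq.ne').symm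
    _ ≤ _ := Real.rpow_le_rpow (Real.rpow_nonneg h0 _) hp.le (inv_pos.2 hq).le

omit [IsProbabilityMeasure P] in
/-- Convergence along `largeDeviationFilter` is uniform convergence over `x > n ^ q`. -/
theorem preciseLargeDeviation_of_tendsto {q b : ℝ}
    (h : Tendsto (fun p : ℕ × ℝ => P.real {ω | p.2 < partialSum X p.1 ω} / (p.1 * tail P X p.2))
      (largeDeviationFilter q) (𝓝 b)) :
    PreciseLargeDeviation P X (fun n : ℕ => Set.Ioi ((n : ℝ) ^ q)) b := by
  unfold PreciseLargeDeviation
  rw [ENNReal.tendsto_nhds_zero]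
  intro ε hε
  have h1 : Tendsto (fun p : ℕ × ℝ => ENNReal.ofReal
      |P.real {ω | p.2 < partialSum X p.1 ω} / (p.1 * tail P X p.2) - b|)
      (largeDeviationFilter q) (𝓝 0) := by
    have := ENNReal.tendsto_ofReal (h.sub_const b).abs
    simpa using this
  have h2 := (ENNReal.tendsto_nhds_zero.1 h1) ε hε
  rw [largeDeviationFilter, eventually_inf_principal, eventually_comap] at h2
  filter_upwards [h2] with n hn
  exact iSup₂_le fun x hx => hn (n, x) rfl hx

end

/-! ### The large deviation principle -/

theorem proposition4p1 {Ω : Type*} [MeasurableSpace Ω] (P : Measure Ω) [IsProbabilityMeasure P]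
    (X : ℤ → Ω → ℝ) (hX : ∀ t, Measurable (X t))
    (hstat : IsStrictlyStationary P X)
    (m₀ : ℕ) (hm₀ : 1 ≤ m₀) (hdep : IsMDependent P X m₀)
    (α : ℝ) (hα : 0 < α) (hRV : IsRegularlyVarying P X α)
    (hmean : Integrable (X 0) P → ∫ ω, X 0 ω ∂P = 0) :
    ∃ b : ℕ → ℝ,
      (∀ k : ℕ, 1 ≤ k → IsTailConstant P X k (b k)) ∧
      Tendsto (fun k : ℕ => b (k + 1) - b k) atTop (𝓝 (b (m₀ + 1) - b m₀)) ∧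
      ∀ δ : ℝ, 0 < δ →
        PreciseLargeDeviation P X
          (fun n : ℕ => Set.Ioi ((n : ℝ) ^ (max (1 / α) (1 / 2) + δ)))
          (b (m₀ + 1) - b m₀) := by
  obtain ⟨hpos, hrv, hex⟩ := hRV.tail_properties hX hstat hα
  have hanti : Antitone (tail P X) := antitone_measureReal_lt _
  choose! b hb using hex
  have hb₀ := hb m₀ hm₀
  have hb₁ := hb (m₀ + 1) (by omega)
  -- a power bound for the tail, together with the corresponding moments
  have hmom : ∀ β, 0 < β → β < α → (∃ C : ℝ, 0 < C ∧ ∀ x, 0 < x → tail P X x ≤ C * x ^ (-β)) ∧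
      Integrable (fun ω => |X 0 ω| ^ β) P := fun β hβ hβα => by
    refine ⟨exists_le_rpow tail_le_one hpos hβ hβα hrv, ?_⟩
    obtain ⟨C, _, hC⟩ := exists_le_rpow tail_le_one hpos (β := (β + α) / 2) (by linarith)
      (by linarith) hrv
    exact integrable_rpow_abs_of_tail_le (hX 0) hβ (by linarith) hC
  have hzero : Tendsto (tail P X) atTop (𝓝 0) := by
    obtain ⟨⟨C, _, hC⟩, _⟩ := hmom (α / 2) (by linarith) (by linarith)
    have := (tendsto_rpow_neg_atTop (half_pos hα)).const_mul C
    rw [mul_zero] at this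
    exact squeeze_zero' (Eventually.of_forall tail_nonneg)
      ((eventually_gt_atTop 0).mono hC) this
  refine ⟨b, hb, ?_, fun δ hδ => ?_⟩
  · refine tendsto_const_nhds.congr' ?_
    filter_upwards [eventually_ge_atTop m₀] with k hk
    have e0 := tailConstant_eq hX hstat hm₀ hdep hpos hzero hrv hb₀ hb₁ hk (hb k (by omega))
    have e1 := tailConstant_eq hX hstat hm₀ hdep hpos hzero hrv hb₀ hb₁
      (hk.trans (Nat.le_succ k)) (hb (k + 1) (by omega))
    rw [e0, e1]
    push_cast
    ring
  set q : ℝ := max (1 / α) (1 / 2) + δ with hq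
  have hqα : 1 / α < q := by linarith [le_max_left (1 / α) (1 / 2)]
  have hq2 : 1 / 2 < q := by linarith [le_max_right (1 / α) (1 / 2)]
  have hq0 : 0 < q := by linarith
  have hγα : q⁻¹ < α := by rwa [inv_lt_comm₀ hq0 hα, inv_eq_one_div]
  have hγ2 : q⁻¹ < 2 := by rwa [inv_lt_comm₀ hq0 two_pos, inv_eq_one_div]
  have hγ0 : 0 < q⁻¹ := inv_pos.2 hq0
  -- a moment between the growth exponent of `n` in terms of `x` and `min α 2`
  obtain ⟨β, hγβ, hβ⟩ := exists_between (lt_min hγα hγ2)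
  have hβ0 : 0 < β := hγ0.trans hγβ
  obtain ⟨⟨C, hC0, hC⟩, hint⟩ := hmom β hβ0 (hβ.trans_le (min_le_left _ _))
  have hsnd := tendsto_snd_largeDeviationFilter hq0
  have hfst := tendsto_fst_largeDeviationFilter q
  have hle := eventually_le_rpow_largeDeviationFilter hq0
  refine preciseLargeDeviation_of_tendsto ?_
  have key := tendsto_partialSum_div hX hstat hm₀ hdep hpos hrv hb₀ hb₁ hsnd
    (tendsto_inv_atTop_zero.comp (tendsto_natCast_atTop_atTop.comp hfst))
    (hfst.eventually (eventually_ge_atTop m₀)) ?_ ?_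
  · simpa using key
  · intro ε hε
    have hlim : Tendsto (fun p : ℕ × ℝ => C * ε ^ (-β) * p.2 ^ (-(β - q⁻¹)))
        (largeDeviationFilter q) (𝓝 0) := by
      simpa using ((tendsto_rpow_neg_atTop (sub_pos.2 hγβ)).comp hsnd).const_mul (C * ε ^ (-β))
    refine squeeze_zero' (Eventually.of_forall fun p =>
      mul_nonneg (Nat.cast_nonneg _) (tail_nonneg _)) ?_ hlim
    filter_upwards [hle, hsnd.eventually (eventually_gt_atTop 0)] with p hp hp0
    calc (p.1 : ℝ) * tail P X (ε * p.2) ≤ p.2 ^ q⁻¹ * (C * (ε * p.2) ^ (-β)) :=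
          mul_le_mul hp (hC _ (by positivity)) (tail_nonneg _) (by positivity)
      _ = C * ε ^ (-β) * (p.2 ^ q⁻¹ * p.2 ^ (-β)) := by
          rw [Real.mul_rpow hε.le hp0.le]; ring
      _ = _ := by
          rw [← Real.rpow_add hp0]
          congr 2
          ring
  · intro η hη
    obtain ⟨c, x₀, hc, hx₀, hlow⟩ := exists_rpow_le hanti hpos (ρ := α + 1) (by linarith)
      (by linarith) hrv
    obtain ⟨ε₀, hε₀, h⟩ := exists_smallSum_tail hX hdep (hstat.identDistrib hX) hβ0
      (hβ.le.trans (min_le_right _ _)) hγβ hint hmean hη (ρ := α + 2) (by linarith)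
    refine ⟨ε₀, hε₀, fun ε hε hε' => ?_⟩
    obtain ⟨K, x₁, hK⟩ := h ε hε hε'
    have hlim : Tendsto (fun p : ℕ × ℝ => K / c * p.2 ^ (-(1 : ℝ)))
        (largeDeviationFilter q) (𝓝 0) := by
      simpa using ((tendsto_rpow_neg_atTop one_pos).comp hsnd).const_mul (K / c)
    refine squeeze_zero' (Eventually.of_forall fun p => div_nonneg measureReal_nonneg
      (mul_nonneg (Nat.cast_nonneg _) (tail_nonneg _))) ?_ hlim
    filter_upwards [hle, hsnd.eventually (eventually_ge_atTop x₀),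
      hsnd.eventually (eventually_ge_atTop x₁), hfst.eventually (eventually_ge_atTop 1)]
      with p hp hp0 hp1 hpn
    have hx : 0 < p.2 := hx₀.trans_le hp0
    have h1 := hK p.2 hp1 p.1 hp
    have h2 : c * p.2 ^ (-(α + 1)) ≤ p.1 * tail P X p.2 :=
      (hlow p.2 hp0).trans (le_mul_of_one_le_left (tail_nonneg _) (by exact_mod_cast hpn))
    have h3 : 0 < c * p.2 ^ (-(α + 1)) := by positivity
    have e : p.2 ^ (-(α + 2)) = p.2 ^ (-(α + 1)) * p.2 ^ (-(1 : ℝ)) := by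
      rw [← Real.rpow_add hx]; ring_nf
    calc P.real {ω | η * p.2 ≤ |smallSum X (ε * p.2) p.1 ω|} / (p.1 * tail P X p.2)
        ≤ (K * p.2 ^ (-(α + 2))) / (c * p.2 ^ (-(α + 1))) :=
          div_le_div₀ (measureReal_nonneg.trans h1) h1 h3 h2
      _ = _ := by
          rw [e]
          field_simp
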